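/- **Definitions.** Let $f=\sum_{v\ge 0}a_vz^v$ be a formal power series with complex coefficients and put $a_k=0$ for $k<0$. For $p,q\in\mathbb N_0=\{0,1,2,\dots\}$ let $\mathfrak D_{p,q}$ be the set of all $f$ whose Hankel determinant $\det\bigl(a_{p-q+1+i+j}\bigr)_{0\le i,j\le q-1}$ is different from $0$ (for $q=0$ this determinant is $1$). A Padé approximant of type $(p,q)$ of $f$ is a quotient $A/B$ of polynomials with $\deg A\le p$, $\deg B\le q$, $B(0)=1$, whose Taylor expansion at $0$ coincides with $f$ in the coefficients of index $0,1,\dots,p+q$; if $f\in\mathfrak D_{p,q}$, it exists, the pair $(A,B)$ is unique, and $A/B$ is denoted by $[p/q]_f$. **Theorem.** Let $\mathfrak J\subset\mathbb N_0\times\mathbb N_0$ contain a sequence $(p_n,q_n)_{n\ge1}$ with $q_n\to\infty$ and $p_n-q_n\to\infty$. Then there is a formal power series $f$ with the following property. For every compact set $K\subset\mathbb C\setminus\{0\}$ and every function $Q$ holomorphic in a neighbourhood of $K$ there is a sequence $(\tilde p_n,\tilde q_n)_{n\ge1}$ in $\mathfrak J$ such that (i) $f\in\mathfrak D_{\tilde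 p_n,\tilde q_n}$ for all $n$, and (ii) the approximants $[\tilde p_n/\tilde q_n]_f$ have no poles on $K$ and converge to $Q$ uniformly on $K$. The set of all such $f$ is a dense $G_\delta$ subset of $\mathbb C^{\mathbb N_0}$ endowed with the Cartesian (product) topology. It is also a dense $G_\delta$ subset of $\mathbb C[[z]]$ endowed with the ring topology, which is given by the metric $d(f,g)=2^{-\kappa}$ for $f\ne g$, where $\kappa$ is the smallest index at which the coefficients of $f$ and $g$ differ, and $d(f,f)=0$. All of these assertions remain true for the set of those $f$ which have this property with the additional requirement in (ii) that the numerator and the denominator of $[\tilde p_n/\tilde q_n]_f$ have exact degrees $\tilde p_n$ and $\tilde q_n$. -/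

import Mathlib

open Filter Topology
open scoped PowerSeries Polynomial

/-- The coefficient `a_k` of `f = ∑ a_v z^v` for an integer index `k`, with `a_k = 0` for `k < 0`. -/
noncomputable def intCoeff (f : ℂ⟦X⟧) (k : ℤ) : ℂ :=
  if 0 ≤ k then PowerSeries.coeff k.toNat f else 0

/-- The Hankel matrix `H_q(a_{p-q+1})` of order `q`: its `(i, j)` entry (indices from `0`) is
`a_{p-q+1+i+j}`. -/
noncomputable def hankel (f : ℂ⟦X⟧) (p q : ℕ) : Matrix (Fin q) (Fin q) ℂ :=
  Matrix.of fun i j => intCoeff f ((p : ℤ) - q + 1 + (i : ℕ) + (j : ℕ))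

/-- The class `𝔇_{p,q}`: the Hankel determinant does not vanish (for `q = 0` it equals `1`). -/
def padeClass (p q : ℕ) : Set ℂ⟦X⟧ := {f | (hankel f p q).det ≠ 0}

/-- `A / B` is a Padé approximant of type `(p, q)` of `f`: `deg A ≤ p`, `deg B ≤ q`, `B(0) = 1`, and
the Taylor series of `A / B` at `0` agrees with `f` in the coefficients of index `0, …, p + q`.
For `f ∈ padeClass p q` there is exactly one such pair. -/
structure IsPadeApproximant (f : ℂ⟦X⟧) (p q : ℕ) (A B : ℂ[X]) : Prop where
  natDegree_num_le : A.natDegree ≤ p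
  natDegree_den_le : B.natDegree ≤ q
  den_coeff_zero : B.coeff 0 = 1
  coeff_eq : ∀ v ≤ p + q,
    PowerSeries.coeff v ((A : ℂ⟦X⟧) * (B : ℂ⟦X⟧)⁻¹) = PowerSeries.coeff v f

/-- A Padé approximant `A / B` whose numerator and denominator have exact degrees `p` and `q`. -/
structure IsExactPadeApproximant (f : ℂ⟦X⟧) (p q : ℕ) (A B : ℂ[X]) : Prop
    extends IsPadeApproximant f p q A B where
  leadingCoeffs_ne_zero : A.coeff p * B.coeff q ≠ 0

/-- `Q` is holomorphic in some open neighbourhood of `K`. -/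
def HolomorphicNear (Q : ℂ → ℂ) (K : Set ℂ) : Prop :=
  ∃ U : Set ℂ, IsOpen U ∧ K ⊆ U ∧ DifferentiableOn ℂ Q U

/-- The rational functions `A n / B n` have no poles on `K` and converge to `Q` uniformly on `K`. -/
def RationalTendstoUniformlyOn (A B : ℕ → ℂ[X]) (Q : ℂ → ℂ) (K : Set ℂ) : Prop :=
  (∀ n, ∀ z ∈ K, (B n).eval z ≠ 0) ∧
    TendstoUniformlyOn (fun n z => (A n).eval z / (B n).eval z) Q atTop K

/-- `J` contains a sequence `(p_n, q_n)` with `q_n → ∞` and `p_n - q_n → ∞`. -/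
def ConditionH (J : Set (ℕ × ℕ)) : Prop :=
  ∃ p q : ℕ → ℕ, (∀ n, (p n, q n) ∈ J) ∧ Tendsto q atTop atTop ∧
    Tendsto (fun n => (p n : ℤ) - (q n : ℤ)) atTop atTop

/-- The formal power series with universal Padé approximants with indices in `J`. -/
def padeUniversal (J : Set (ℕ × ℕ)) : Set ℂ⟦X⟧ :=
  {f | ∀ K : Set ℂ, IsCompact K → (0 : ℂ) ∉ K → ∀ Q : ℂ → ℂ, HolomorphicNear Q K →
    ∃ (p q : ℕ → ℕ) (A B : ℕ → ℂ[X]),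
      (∀ n, (p n, q n) ∈ J) ∧
      (∀ n, f ∈ padeClass (p n) (q n)) ∧
      (∀ n, IsPadeApproximant f (p n) (q n) (A n) (B n)) ∧
      RationalTendstoUniformlyOn A B Q K}

/-- As `padeUniversal`, with approximants whose numerator and denominator have exact degrees
`p_n` and `q_n`. -/
def exactPadeUniversal (J : Set (ℕ × ℕ)) : Set ℂ⟦X⟧ :=
  {f | ∀ K : Set ℂ, IsCompact K → (0 : ℂ) ∉ K → ∀ Q : ℂ → ℂ, HolomorphicNear Q K →
    ∃ (p q : ℕ → ℕ) (A B : ℕ → ℂ[X]),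
      (∀ n, (p n, q n) ∈ J) ∧
      (∀ n, f ∈ padeClass (p n) (q n)) ∧
      (∀ n, IsExactPadeApproximant f (p n) (q n) (A n) (B n)) ∧
      RationalTendstoUniformlyOn A B Q K}

/-- The Cartesian (product) topology of `ℂ^ℕ₀`: the topology of convergence of every coefficient. -/
@[reducible] noncomputable def cartesianTopology : TopologicalSpace ℂ⟦X⟧ :=
  TopologicalSpace.induced (fun f (n : ℕ) => PowerSeries.coeff n f) Pi.topologicalSpace

/-- The distance `2 ^ (-κ)`, with `κ` the least index at which the coefficients of `f` and `g`
differ, and `0` if `f = g`. -/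
noncomputable def ringDist (f g : ℂ⟦X⟧) : ℝ :=
  open Classical in
  if f = g then 0
  else (1 / 2 : ℝ) ^ sInf {k : ℕ | PowerSeries.coeff k f ≠ PowerSeries.coeff k g}

theorem ringDist_self (f : ℂ⟦X⟧) : ringDist f f = 0 := by simp [ringDist]

theorem ringDist_nonneg (f g : ℂ⟦X⟧) : 0 ≤ ringDist f g := by
  unfold ringDist; split_ifs <;> positivity

theorem eq_of_ringDist_eq_zero {f g : ℂ⟦X⟧} (h : ringDist f g = 0) : f = g := by
  by_contra hne
  rw [ringDist, if_neg hne] at h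
  exact absurd h (by positivity)

theorem ringDist_comm (f g : ℂ⟦X⟧) : ringDist f g = ringDist g f := by
  unfold ringDist
  by_cases h : f = g
  · rw [if_pos h, if_pos h.symm]
  · rw [if_neg h, if_neg (Ne.symm h)]
    simp only [ne_comm]

theorem ringDist_triangle (f g h : ℂ⟦X⟧) : ringDist f h ≤ ringDist f g + ringDist g h := by
  by_cases hfg : f = g
  · subst hfg; simp [ringDist_self]
  by_cases hgh : g = h
  · subst hgh; simp [ringDist_self]
  by_cases hfh : f = h
  · subst hfh
    rw [ringDist_self]
    exact add_nonneg (ringDist_nonneg _ _) (ringDist_nonneg _ _)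
  have hne : {k : ℕ | PowerSeries.coeff k f ≠ PowerSeries.coeff k h}.Nonempty := by
    by_contra hemp
    apply hfh
    ext k
    by_contra hk
    exact hemp ⟨k, hk⟩
  have hmem := Nat.sInf_mem hne
  set k := sInf {k : ℕ | PowerSeries.coeff k f ≠ PowerSeries.coeff k h} with hk
  have hd : ringDist f h = (1 / 2 : ℝ) ^ k := by rw [ringDist, if_neg hfh]
  have key : ∀ u v : ℂ⟦X⟧, u ≠ v → PowerSeries.coeff k u ≠ PowerSeries.coeff k v →
      (1 / 2 : ℝ) ^ k ≤ ringDist u v := by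
    intro u v huv hc
    rw [ringDist, if_neg huv]
    exact pow_le_pow_of_le_one (by norm_num) (by norm_num) (Nat.sInf_le hc)
  rw [hd]
  by_cases hc : PowerSeries.coeff k f = PowerSeries.coeff k g
  · have := key g h hgh (fun e => hmem (hc.trans e))
    linarith [ringDist_nonneg f g]
  · have := key f g hfg hc
    linarith [ringDist_nonneg g h]

/-- The metric of the ring of formal power series. -/
@[reducible] noncomputable def ringMetric : MetricSpace ℂ⟦X⟧ where
  dist := ringDist
  dist_self := ringDist_self
  dist_comm := ringDist_comm
  dist_triangle := ringDist_triangle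
  eq_of_dist_eq_zero := eq_of_ringDist_eq_zero

/-- The topology of the ring of formal power series, given by its metric. -/
@[reducible] noncomputable def ringTopology : TopologicalSpace ℂ⟦X⟧ :=
  ringMetric.toUniformSpace.toTopologicalSpace

/-! The proof is by Baire category. Where the Hankel determinant is nonzero, Cramer's rule makes the
coefficients of the Padé approximant continuous functions of finitely many coefficients of `f`. So
for fixed `K`, `Q`, `ε` the series with an approximant, indexed in `J`, that is `ε`-close to `Q` on
`K` form an open set. Countably many triples `(K, Q, ε)` suffice (`padeUniversalWith_eq_sInter`), so
the universal series form a `Gδ` set.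

For density, a prescribed jet at the origin must be continued to a series in such an open set. As `0
∉ K`, Runge's theorem on `insert 0 K` yields a rational function close to `Q` on `K` with that jet
(`HolomorphicNear.exists_rational_approx_with_jet`). A small perturbation, of high order at the
origin, makes it reduced with exact degrees `(p, q)` in `J` (`exists_isCoprime_approx`). Such a
fraction is its own Padé approximant, and its Hankel determinant is nonzero
(`mem_padeClass_of_isCoprime`).

Runge's theorem is obtained from the Cauchy–Pompeiu formula, read as an integral with values in
`C(K, ℂ)`. -/

/-! ### The Cauchy–Pompeiu formula and Runge's theorem -/

open MeasureTheory in
/-- The **Cauchy–Pompeiu formula** at the origin for compactly supported functions. -/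
theorem integral_dbar_div_eq_at_zero {g : ℂ → ℂ} (hg : ContDiff ℝ 1 g)
    (hc : HasCompactSupport g) :
    ∫ w, (fderiv ℝ g w 1 + Complex.I * fderiv ℝ g w Complex.I) / w = -(2 * Real.pi) * g 0 := by
  set e : ℝ → ℂ := fun θ => Real.cos θ + Real.sin θ * Complex.I with he
  have he0 : ∀ θ, e θ ≠ 0 := fun θ h => by
    have : ‖e θ‖ = 1 := by
      simp only [he, Complex.ofReal_cos, Complex.ofReal_sin]
      exact Complex.norm_cos_add_sin_mul_I θ
    simp [h] at this
  have hec : Continuous e := by fun_prop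
  have hed : ∀ θ, HasDerivAt e (Complex.I * e θ) θ := fun θ => by
    have h1 := (Real.hasDerivAt_cos θ).ofReal_comp
    have h2 := ((Real.hasDerivAt_sin θ).ofReal_comp).mul_const Complex.I
    refine (h1.add h2).congr_deriv ?_
    simp only [he, Complex.ofReal_neg]
    linear_combination -((Real.sin θ : ℝ) : ℂ) * Complex.I_sq
  have hfc : Continuous (fderiv ℝ g) := hg.continuous_fderiv one_ne_zero
  have hdiff : Differentiable ℝ g := hg.differentiable one_ne_zero
  obtain ⟨R, hR⟩ : ∃ R : ℝ, ∀ w, R ≤ ‖w‖ → w ∉ tsupport g := by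
    obtain ⟨R, hR⟩ := hc.isCompact.isBounded.subset_ball (0 : ℂ)
    exact ⟨R, fun w hw h => by simpa using (mem_ball_zero_iff.1 (hR h)).trans_le hw⟩
  have hnorm : ∀ (r θ : ℝ), ‖(r : ℂ) * e θ‖ = |r| := fun r θ => by
    rw [norm_mul, Complex.norm_real, Real.norm_eq_abs]
    simp only [he, Complex.ofReal_cos, Complex.ofReal_sin, Complex.norm_cos_add_sin_mul_I, mul_one]
  set S : Set (ℝ × ℝ) := Set.Ioi (0 : ℝ) ×ˢ Set.Ioo (-Real.pi) Real.pi with hS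
  have hint : ∀ F : ℝ × ℝ → ℂ, Continuous F → (∀ p : ℝ × ℝ, R ≤ |p.1| → F p = 0) →
      IntegrableOn F S (volume.prod volume) := by
    intro F hF h0
    have h1 : IntegrableOn F (Set.Icc 0 R ×ˢ Set.Icc (-Real.pi) Real.pi)
        (volume.prod volume) :=
      hF.continuousOn.integrableOn_compact (isCompact_Icc.prod isCompact_Icc)
    refine h1.of_forall_sdiff_eq_zero (measurableSet_Ioi.prod measurableSet_Ioo) ?_
    rintro ⟨r, θ⟩ ⟨⟨hr, hθ⟩, hn⟩
    apply h0
    by_contra hlt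
    apply hn
    simp only [Set.mem_Ioi] at hr
    rw [not_le, abs_of_pos hr] at hlt
    exact ⟨⟨hr.le, hlt.le⟩, ⟨hθ.1.le, hθ.2.le⟩⟩
  have hfz : ∀ (r θ : ℝ), R ≤ |r| → fderiv ℝ g (r * e θ) = 0 := fun r θ hr =>
    image_eq_zero_of_notMem_tsupport fun h =>
      hR _ (by rwa [hnorm]) (tsupport_fderiv_subset ℝ h)
  -- In polar coordinates the Jacobian `r` cancels the modulus of `w`, and the integrand becomes
  -- `∂_r g + (i/r) ∂_θ g`. These are `F₁` and `F₂`: the first integrates to `-g 0` along every ray,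
  -- the second to `0` over every circle.
  set F₁ : ℝ × ℝ → ℂ := fun p => fderiv ℝ g (p.1 * e p.2) (e p.2) with hF₁
  set F₂ : ℝ × ℝ → ℂ := fun p => Complex.I * fderiv ℝ g (p.1 * e p.2) (Complex.I * e p.2) with hF₂
  have hF₁i : IntegrableOn F₁ S (volume.prod volume) := by
    refine hint _ ?_ fun p hp => by simp [hF₁, hfz _ _ hp]
    exact (hfc.comp (by fun_prop)).clm_apply (by fun_prop)
  have hF₂i : IntegrableOn F₂ S (volume.prod volume) := by
    refine hint _ ?_ fun p hp => by simp [hF₂, hfz _ _ hp]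
    exact continuous_const.mul ((hfc.comp (by fun_prop)).clm_apply (by fun_prop))
  have hpolar : ∫ w, (fderiv ℝ g w 1 + Complex.I * fderiv ℝ g w Complex.I) / w
      = ∫ p in S, (F₁ p + F₂ p) := by
    rw [← Complex.integral_comp_polarCoord_symm]
    refine setIntegral_congr_fun (measurableSet_Ioi.prod measurableSet_Ioo) ?_
    rintro ⟨r, θ⟩ ⟨hr, -⟩
    have hr0 : (r : ℂ) ≠ 0 := by exact_mod_cast (Set.mem_Ioi.1 hr).ne'
    have hpt : Complex.polarCoord.symm (r, θ) = r * e θ := by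
      simp [he]
    simp only [hpt, hF₁, hF₂]
    set L := fderiv ℝ g (r * e θ)
    have hL : ∀ a b : ℝ, L (a + b * Complex.I) = a * L 1 + b * L Complex.I := fun a b => by
      have : (a + b * Complex.I : ℂ) = a • (1 : ℂ) + b • Complex.I := by simp
      rw [this, map_add, map_smul, map_smul]; simp
    have h1 : L (e θ) = Real.cos θ * L 1 + Real.sin θ * L Complex.I := hL _ _
    have h2 : L (Complex.I * e θ) = -Real.sin θ * L 1 + Real.cos θ * L Complex.I := by
      have : Complex.I * e θ = ((-Real.sin θ : ℝ) : ℂ) + (Real.cos θ : ℝ) * Complex.I := by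
        simp only [he, Complex.ofReal_neg]
        linear_combination ((Real.sin θ : ℝ) : ℂ) * Complex.I_sq
      rw [this, hL]; push_cast; ring
    have hinv : e θ * (Real.cos θ - Real.sin θ * Complex.I) = 1 := by
      have h3 : ((Real.cos θ : ℝ) : ℂ) ^ 2 + ((Real.sin θ : ℝ) : ℂ) ^ 2 = 1 := by
        exact_mod_cast Real.cos_sq_add_sin_sq θ
      simp only [he]
      linear_combination h3 - ((Real.sin θ : ℝ) : ℂ) ^ 2 * Complex.I_sq
    rw [h1, h2, Complex.real_smul]
    have h4 : (r : ℂ) * ((L 1 + Complex.I * L Complex.I) / (r * e θ)) =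
        (L 1 + Complex.I * L Complex.I) * (Real.cos θ - Real.sin θ * Complex.I) := by
      rw [← inv_eq_of_mul_eq_one_right hinv]
      have := he0 θ
      field_simp
    rw [h4]
    linear_combination -(Real.sin θ : ℂ) * L Complex.I * Complex.I_sq
  have hone : ∫ p in S, F₁ p = -(2 * Real.pi) * g 0 := by
    rw [Measure.volume_eq_prod]
    have hsw : ∫ p in S, F₁ p ∂(volume.prod volume) =
        ∫ θ in Set.Ioo (-Real.pi) Real.pi, ∫ r in Set.Ioi (0 : ℝ), F₁ (r, θ) := by
      rw [hS, setIntegral_prod _ hF₁i]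
      apply integral_integral_swap
      rw [IntegrableOn, hS, ← Measure.prod_restrict] at hF₁i
      exact hF₁i
    rw [hsw]
    have hin : ∀ θ : ℝ, ∫ r in Set.Ioi (0 : ℝ), F₁ (r, θ) = -g 0 := fun θ => by
      have hcd : ContDiff ℝ 1 fun r : ℝ => g (r * e θ) := by
        refine hg.comp ?_
        exact (Complex.ofRealCLM.contDiff).mul contDiff_const
      have hcs : HasCompactSupport fun r : ℝ => g (r * e θ) := by
        refine HasCompactSupport.intro (isCompact_Icc (a := -R) (b := R)) fun r hr => ?_
        refine image_eq_zero_of_notMem_tsupport (hR _ ?_)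
        rw [hnorm]
        by_contra hlt
        exact hr (abs_le.1 (not_le.1 hlt).le)
      have := hcs.integral_Ioi_deriv_eq hcd 0
      simp only [Complex.ofReal_zero, zero_mul] at this
      rw [← this]
      congr 1
      ext r
      have h1 : HasDerivAt (fun r : ℝ => (r : ℂ) * e θ) (e θ) r := by
        simpa using (Complex.ofRealCLM.hasDerivAt (x := r)).mul_const (e θ)
      exact ((hdiff _).hasFDerivAt.comp_hasDerivAt r h1).deriv.symm
    simp only [hin]
    rw [setIntegral_const, measureReal_def, Real.volume_Ioo,
      ENNReal.toReal_ofReal (by linarith [Real.pi_pos]), Complex.real_smul]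
    push_cast; ring
  have htwo : ∫ p in S, F₂ p = 0 := by
    rw [Measure.volume_eq_prod, hS, setIntegral_prod _ hF₂i]
    refine setIntegral_eq_zero_of_forall_eq_zero fun r hr => ?_
    have hr0 : (r : ℂ) ≠ 0 := by exact_mod_cast (Set.mem_Ioi.1 hr).ne'
    -- The antiderivative in `θ` takes equal values at `-π` and `π`.
    have hder : ∀ θ : ℝ, HasDerivAt (fun θ : ℝ => Complex.I * (r : ℂ)⁻¹ * g (r * e θ))
        (F₂ (r, θ)) θ := fun θ => by
      have h1 : HasDerivAt (fun θ : ℝ => (r : ℂ) * e θ) (r * (Complex.I * e θ)) θ :=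
        (hed θ).const_mul _
      have h2 := ((hdiff _).hasFDerivAt.comp_hasDerivAt θ h1).const_mul (Complex.I * (r : ℂ)⁻¹)
      refine h2.congr_deriv ?_
      have : (r : ℂ) * (Complex.I * e θ) = r • (Complex.I * e θ) := by simp
      rw [this, map_smul, Complex.real_smul]
      simp only [hF₂]
      field_simp
    rw [← integral_Ioc_eq_integral_Ioo,
      ← intervalIntegral.integral_of_le (by linarith [Real.pi_pos]),
      intervalIntegral.integral_eq_sub_of_hasDerivAt (fun θ _ => hder θ)]
    · simp [he]
    · refine Continuous.intervalIntegrable ?_ _ _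
      exact continuous_const.mul ((hfc.comp (by fun_prop)).clm_apply (by fun_prop))
  rw [hpolar, Measure.volume_eq_prod, integral_add hF₁i hF₂i, ← Measure.volume_eq_prod, hone, htwo, add_zero]

open MeasureTheory in
/-- The **Cauchy–Pompeiu formula** for compactly supported functions. -/
theorem integral_dbar_div_sub_eq {g : ℂ → ℂ} (hg : ContDiff ℝ 1 g)
    (hc : HasCompactSupport g) (z : ℂ) :
    ∫ w, (fderiv ℝ g w 1 + Complex.I * fderiv ℝ g w Complex.I) / (w - z) =
      -(2 * Real.pi) * g z := by
  have h := integral_dbar_div_eq_at_zero (g := fun w => g (w + z))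
    (hg.comp (contDiff_id.add contDiff_const))
    (hc.comp_homeomorph (Homeomorph.addRight z))
  rw [← integral_add_right_eq_self _ z]
  simpa [fderiv_comp_add_right] using h

open MeasureTheory in
/-- The integral over a compact set of a continuous function with values in a submodule lies in the
closure of that submodule. -/
theorem setIntegral_mem_topologicalClosure {E : Type*} [NormedAddCommGroup E] [NormedSpace ℂ E]
    [CompleteSpace E] (M : Submodule ℂ E) {ψ : ℂ → E} (hψ : Continuous ψ) (hM : ∀ w, ψ w ∈ M)
    {t : Set ℂ} (ht : IsCompact t) : ∫ w in t, ψ w ∈ M.topologicalClosure := by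
  rcases eq_or_ne (volume t) 0 with h0 | h0
  · rw [Measure.restrict_eq_zero.2 h0, integral_zero_measure]
    exact zero_mem _
  -- On a set of positive finite measure the integral is a real multiple of an average, and averages
  -- stay in a closed convex set.
  · have hconv : Convex ℝ (M.topologicalClosure : Set E) :=
      (M.topologicalClosure.restrictScalars ℝ).convex
    have hmem := hconv.set_average_mem M.isClosed_topologicalClosure h0 ht.measure_lt_top.ne
      (ae_of_all _ fun w => M.le_topologicalClosure (hM w)) (hψ.continuousOn.integrableOn_compact ht)
    rw [← measure_smul_setAverage _ ht.measure_lt_top.ne]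
    exact (M.topologicalClosure.restrictScalars ℝ).smul_mem _ hmem

/-- The continuous functions on `K` which are quotients of polynomials. -/
noncomputable def rationalFunctionsOn (K : Set ℂ) : Submodule ℂ C(K, ℂ) where
  carrier := {u | ∃ A B : ℂ[X], ∀ z : K, B.eval (z : ℂ) ≠ 0 ∧ u z = A.eval (z : ℂ) / B.eval (z : ℂ)}
  zero_mem' := ⟨0, 1, fun z => by simp⟩
  add_mem' := by
    rintro u v ⟨A, B, h⟩ ⟨C, D, h'⟩
    refine ⟨A * D + B * C, B * D, fun z => ?_⟩
    have h1 := (h z).1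
    have h2 := (h' z).1
    refine ⟨by simp [h1, h2], ?_⟩
    rw [ContinuousMap.add_apply, (h z).2, (h' z).2]
    simp only [Polynomial.eval_add, Polynomial.eval_mul]
    rw [div_add_div _ _ h1 h2]
  smul_mem' := by
    rintro c u ⟨A, B, h⟩
    refine ⟨Polynomial.C c * A, B, fun z => ⟨(h z).1, ?_⟩⟩
    rw [ContinuousMap.smul_apply, (h z).2]
    simp [mul_div_assoc]

/-- A function holomorphic near a compact set `K` agrees on `K` with a `C¹` function supported in a
compact set whose `∂̄`-derivative vanishes near `K`. -/
theorem HolomorphicNear.exists_contDiff_extension {K : Set ℂ} (hK : IsCompact K) {Q : ℂ → ℂ}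
    (hQ : HolomorphicNear Q K) :
    ∃ g : ℂ → ℂ, ContDiff ℝ 1 g ∧ HasCompactSupport g ∧ (∀ z ∈ K, g z = Q z) ∧
      ∀ z ∈ K, ∀ᶠ w in 𝓝 z, fderiv ℝ g w 1 + Complex.I * fderiv ℝ g w Complex.I = 0 := by
  obtain ⟨U, hU, hKU, hQU⟩ := hQ
  obtain ⟨t, ht, hKt, htU⟩ := exists_compact_between hK hU hKU
  obtain ⟨φ, hφ1, hφ0, -⟩ := exists_contMDiffMap_one_nhds_of_subset_interior
    (modelWithCornersSelf ℝ ℂ) (n := 1) hK.isClosed hKt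
  have hφ : ContDiff ℝ 1 φ := contMDiff_iff_contDiff.1 φ.contMDiff
  have hloc : ∀ z ∈ K, ∀ᶠ w in 𝓝 z, (φ w : ℂ) * Q w = Q w := fun z hz => by
    have : ∀ᶠ w in 𝓝 z, φ w = 1 := hφ1.filter_mono (nhds_le_nhdsSet hz)
    filter_upwards [this] with w hw
    simp [hw]
  refine ⟨fun w => (φ w : ℂ) * Q w, contDiff_iff_contDiffAt.2 fun x => ?_, ?_, ?_, ?_⟩
  · by_cases hx : x ∈ U
    · have h1 : ContDiffAt ℝ 1 Q x :=
        ((hQU.contDiffOn hU).contDiffAt (hU.mem_nhds hx)).restrict_scalars ℝ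
      have h2 : ContDiffAt ℝ 1 (fun w => (φ w : ℂ)) x :=
        (Complex.ofRealCLM.contDiff.comp hφ).contDiffAt
      exact h2.mul h1
    · refine (contDiffAt_const (c := (0 : ℂ))).congr_of_eventuallyEq ?_
      filter_upwards [ht.isClosed.isOpen_compl.mem_nhds fun h => hx (htU h)] with w hw
      simp [hφ0 w hw]
  · exact HasCompactSupport.intro ht fun x hx => by simp [hφ0 x hx]
  · exact fun z hz => (hloc z hz).self_of_nhds
  · intro z hz
    filter_upwards [(hloc z hz).eventually_nhds, hU.mem_nhds (hKU hz)] with w hw hwU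
    have hd : DifferentiableAt ℂ Q w := hQU.differentiableAt (hU.mem_nhds hwU)
    have hw' : (fun w => (φ w : ℂ) * Q w) =ᶠ[𝓝 w] Q := hw
    rw [hw'.fderiv_eq, hd.fderiv_restrictScalars ℝ]
    simp only [ContinuousLinearMap.coe_restrictScalars', fderiv_eq_smul_deriv, smul_eq_mul]
    linear_combination deriv Q w * Complex.I_mul_I

open MeasureTheory in
/-- **Runge's theorem**: a function holomorphic near a compact set is there a uniform limit of
rational functions without poles on the set. -/
theorem HolomorphicNear.exists_rational_approx {K : Set ℂ} (hK : IsCompact K) {Q : ℂ → ℂ}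
    (hQ : HolomorphicNear Q K) {ε : ℝ} (hε : 0 < ε) :
    ∃ A B : ℂ[X], ∀ z ∈ K, B.eval z ≠ 0 ∧ ‖A.eval z / B.eval z - Q z‖ < ε := by
  obtain ⟨g, hg, hc, hgQ, hdbar⟩ := hQ.exists_contDiff_extension hK
  have : CompactSpace K := isCompact_iff_compactSpace.1 hK
  set h : ℂ → ℂ := fun w => fderiv ℝ g w 1 + Complex.I * fderiv ℝ g w Complex.I with hh
  have hfc : Continuous (fderiv ℝ g) := hg.continuous_fderiv one_ne_zero
  have hcont : Continuous h := by fun_prop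
  -- The Cauchy kernel is singular only at `w = z ∈ K`, and there `h` vanishes in a whole
  -- neighbourhood. Joint continuity allows currying into a continuous map to `C(K, ℂ)`.
  have hker : Continuous fun p : ℂ × K => h p.1 / (p.1 - p.2) := by
    refine continuous_iff_continuousAt.2 fun ⟨w, z⟩ => ?_
    by_cases hwz : w = z
    · have h0 : ∀ᶠ p : ℂ × K in 𝓝 (w, z), h p.1 = 0 := by
        have hd : ∀ᶠ y in 𝓝 w, h y = 0 := hwz ▸ hdbar z z.2
        exact ((continuous_fst (X := ℂ) (Y := K)).tendsto (w, z)).eventually hd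
      refine ContinuousAt.congr (continuousAt_const (y := (0 : ℂ))) ?_
      filter_upwards [h0] with p hp
      simp [hp]
    · refine ContinuousAt.div (by fun_prop) (by fun_prop) (sub_ne_zero.2 hwz)
  set ψ : C(ℂ, C(K, ℂ)) := ContinuousMap.curry ⟨_, hker⟩ with hψ
  have hψM : ∀ w, ψ w ∈ rationalFunctionsOn K := fun w => by
    -- For `w ∈ K` the numerator `h w` is `0`, so the value is `0` even at `z = w`, where the
    -- quotient is `0 / 0 = 0`. For `w ∉ K` the only pole lies off `K`.
    by_cases hw : w ∈ K
    · convert zero_mem (rationalFunctionsOn K)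
      ext z
      simp [hψ, (hdbar w hw).self_of_nhds, hh]
    · refine ⟨Polynomial.C (h w), Polynomial.C w - Polynomial.X, fun z => ⟨?_, ?_⟩⟩
      · have : w ≠ z := fun e => hw (e ▸ z.2)
        simpa [sub_eq_zero] using this
      · simp [hψ]
  have hh0 : ∀ w, w ∉ tsupport g → h w = 0 := fun w hw => by
    have : fderiv ℝ g w = 0 := image_eq_zero_of_notMem_tsupport
      fun h => hw (tsupport_fderiv_subset ℝ h)
    simp [hh, this]
  have hmem := setIntegral_mem_topologicalClosure (rationalFunctionsOn K) ψ.continuous hψM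
    hc.isCompact
  set T : C(K, ℂ) := ∫ w in tsupport g, ψ w with hT
  have hTz : ∀ z : K, T z = -(2 * Real.pi) * Q z := fun z => by
    have h1 : T z = ∫ w in tsupport g, ψ w z := by
      have := (ContinuousMap.evalCLM ℂ z).integral_comp_comm
        (ψ.continuous.continuousOn.integrableOn_compact (μ := volume) hc.isCompact)
      simpa using this.symm
    rw [h1, ← hgQ z z.2, ← integral_dbar_div_sub_eq hg hc z]
    refine setIntegral_eq_integral_of_forall_compl_eq_zero fun w hw => ?_
    simp [hψ, hh0 w hw]
  have hpi : (-(2 * Real.pi) : ℂ) ≠ 0 := by simp [Real.pi_ne_zero]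
  obtain ⟨u, hu, huε⟩ := Metric.mem_closure_iff.1
    ((rationalFunctionsOn K).topologicalClosure.smul_mem (-(2 * Real.pi) : ℂ)⁻¹ hmem) ε hε
  obtain ⟨A, B, hAB⟩ := hu
  refine ⟨A, B, fun z hz => ⟨(hAB ⟨z, hz⟩).1, ?_⟩⟩
  have h1 := (ContinuousMap.dist_apply_le_dist (f := (-(2 * Real.pi) : ℂ)⁻¹ • T) (g := u)
    ⟨z, hz⟩).trans_lt huε
  rw [dist_comm, dist_eq_norm, (hAB ⟨z, hz⟩).2, ContinuousMap.smul_apply, hTz, smul_eq_mul,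
    inv_mul_cancel_left₀ hpi] at h1
  exact h1

/-! ### Congruences between power series and polynomials -/

section PowerSeriesCongruence

theorem coeff_mul_coe_eq_sum_range (f : ℂ⟦X⟧) {B : ℂ[X]} {q : ℕ} (hB : B.natDegree ≤ q) (n : ℕ) :
    PowerSeries.coeff n (f * (B : ℂ⟦X⟧)) =
      ∑ k ∈ Finset.range (q + 1), intCoeff f ((n : ℤ) - k) * B.coeff k := by
  conv_lhs => rw [B.as_sum_range' (q + 1) (Nat.lt_succ_of_le hB)]
  rw [← Polynomial.coeToPowerSeries.ringHom_apply, map_sum, Finset.mul_sum, map_sum]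
  refine Finset.sum_congr rfl fun k _ => ?_
  rw [Polynomial.coeToPowerSeries.ringHom_apply, ← Polynomial.C_mul_X_pow_eq_monomial,
    Polynomial.coe_mul, Polynomial.coe_pow, Polynomial.coe_X, Polynomial.coe_C, ← mul_assoc,
    PowerSeries.coeff_mul_X_pow']
  unfold intCoeff
  by_cases h : k ≤ n
  · rw [if_pos h, if_pos (by lia), PowerSeries.coeff_mul_C]
    congr 3
    lia
  · rw [if_neg h, if_neg (by lia), zero_mul]

theorem coe_eq_zero_of_X_pow_dvd {P : ℂ[X]} {n : ℕ} (hP : P.natDegree < n)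
    (h : (PowerSeries.X : ℂ⟦X⟧) ^ n ∣ (P : ℂ⟦X⟧)) : P = 0 := by
  ext k
  by_cases hk : k < n
  · simpa using PowerSeries.X_pow_dvd_iff.1 h k hk
  · exact Polynomial.coeff_eq_zero_of_natDegree_lt (by lia)

theorem coe_mul_inv_cancel {B : ℂ[X]} (hB : B.coeff 0 = 1) : (B : ℂ⟦X⟧) * (B : ℂ⟦X⟧)⁻¹ = 1 :=
  PowerSeries.mul_inv_cancel _ (by simp [hB])

theorem X_pow_dvd_mul_inv_sub_iff {A B : ℂ[X]} (hB : B.coeff 0 = 1) (f : ℂ⟦X⟧) (n : ℕ) :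
    (PowerSeries.X : ℂ⟦X⟧) ^ n ∣ (A : ℂ⟦X⟧) * (B : ℂ⟦X⟧)⁻¹ - f ↔
      (PowerSeries.X : ℂ⟦X⟧) ^ n ∣ f * (B : ℂ⟦X⟧) - (A : ℂ⟦X⟧) := by
  have h := coe_mul_inv_cancel hB
  constructor
  · intro hd
    have : f * (B : ℂ⟦X⟧) - A = -(B : ℂ⟦X⟧) * ((A : ℂ⟦X⟧) * (B : ℂ⟦X⟧)⁻¹ - f) := by
      linear_combination (A : ℂ⟦X⟧) * h
    exact this ▸ hd.mul_left _
  · intro hd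
    have : (A : ℂ⟦X⟧) * (B : ℂ⟦X⟧)⁻¹ - f = -(B : ℂ⟦X⟧)⁻¹ * (f * (B : ℂ⟦X⟧) - A) := by
      linear_combination f * h
    exact this ▸ hd.mul_left _

theorem X_pow_succ_dvd_sub_iff (f g : ℂ⟦X⟧) (n : ℕ) :
    (PowerSeries.X : ℂ⟦X⟧) ^ (n + 1) ∣ f - g ↔
      ∀ v ≤ n, PowerSeries.coeff v f = PowerSeries.coeff v g := by
  simp only [PowerSeries.X_pow_dvd_iff, Nat.lt_succ_iff, map_sub, sub_eq_zero]

theorem coe_trunc_coeff (f : ℂ⟦X⟧) (p k : ℕ) :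
    PowerSeries.coeff k (PowerSeries.trunc (p + 1) f : ℂ⟦X⟧) =
      if k ≤ p then PowerSeries.coeff k f else 0 := by
  simp [PowerSeries.coeff_trunc]

theorem natDegree_trunc_succ_le (f : ℂ⟦X⟧) (p : ℕ) :
    (PowerSeries.trunc (p + 1) f).natDegree ≤ p :=
  Nat.lt_succ_iff.1 (PowerSeries.natDegree_trunc_lt f p)

/-- If the coefficients `p + 1, …, p + q` of `f` vanish, then `f` agrees with its truncation
at `p` up to order `p + q`. -/
theorem X_pow_dvd_sub_trunc {f : ℂ⟦X⟧} {p q : ℕ}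
    (h : ∀ i : Fin q, PowerSeries.coeff (p + 1 + i) f = 0) :
    (PowerSeries.X : ℂ⟦X⟧) ^ (p + q + 1) ∣ f - (PowerSeries.trunc (p + 1) f : ℂ⟦X⟧) := by
  rw [X_pow_succ_dvd_sub_iff]
  intro v hv
  rw [coe_trunc_coeff]
  split_ifs with hvp
  · rfl
  · have := h ⟨v - (p + 1), by lia⟩
    rwa [show p + 1 + (v - (p + 1)) = v by lia] at this

end PowerSeriesCongruence

/-! ### Hankel determinants and reduced fractions -/

section Hankel

/-- Read backwards, the coefficients of `B` of index `1, …, q` are the unknowns of a Hankel system,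
and the `B.coeff 0` term of the convolution is its inhomogeneous part. This translates Padé
conditions into linear algebra and back. -/
theorem coeff_mul_coe_eq_hankel_mulVec (f : ℂ⟦X⟧) (p : ℕ) {B : ℂ[X]} {q : ℕ}
    (hB : B.natDegree ≤ q) (i : Fin q) :
    PowerSeries.coeff (p + 1 + i) (f * (B : ℂ⟦X⟧)) =
      (hankel f p q).mulVec (fun j => B.coeff (q - j)) i +
        PowerSeries.coeff (p + 1 + i) f * B.coeff 0 := by
  rw [coeff_mul_coe_eq_sum_range f hB, Finset.sum_range_succ']
  congr 1
  · rw [← Finset.sum_range_reflect, Finset.sum_range, Matrix.mulVec, dotProduct]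
    refine Finset.sum_congr rfl fun j _ => ?_
    have hj := j.2
    simp only [hankel, Matrix.of_apply]
    rw [show q - 1 - (j : ℕ) + 1 = q - j by lia]
    congr 2
    push_cast [Nat.cast_sub hj.le]
    ring

/-- The polynomial `∑ j, x j * X ^ (q - j)`. -/
noncomputable def polynomialOfVec {q : ℕ} (x : Fin q → ℂ) : ℂ[X] :=
  ∑ j : Fin q, Polynomial.C (x j) * Polynomial.X ^ (q - (j : ℕ))

theorem polynomialOfVec_coeff_sub {q : ℕ} (x : Fin q → ℂ) (j : Fin q) :
    (polynomialOfVec x).coeff (q - j) = x j := by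
  rw [polynomialOfVec, Polynomial.finsetSum_coeff, Finset.sum_eq_single j]
  · simp
  · intro k _ hkj
    rw [Polynomial.coeff_C_mul_X_pow, if_neg]
    intro h
    apply hkj
    ext
    lia
  · simp

theorem polynomialOfVec_coeff_zero {q : ℕ} (x : Fin q → ℂ) : (polynomialOfVec x).coeff 0 = 0 := by
  rw [polynomialOfVec, Polynomial.finsetSum_coeff]
  refine Finset.sum_eq_zero fun j _ => ?_
  rw [Polynomial.coeff_C_mul_X_pow, if_neg]
  lia

theorem natDegree_polynomialOfVec_le {q : ℕ} (x : Fin q → ℂ) :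
    (polynomialOfVec x).natDegree ≤ q :=
  Polynomial.natDegree_sum_le_of_forall_le _ _ fun _ _ =>
    (Polynomial.natDegree_C_mul_X_pow_le _ _).trans (Nat.sub_le _ _)

/-- The Hankel determinant of the Taylor series of a reduced fraction with denominator of exact
degree `q` does not vanish. -/
theorem mem_padeClass_of_isCoprime {A B : ℂ[X]} {p q : ℕ} (hA : A.natDegree ≤ p)
    (hB : B.natDegree = q) (hB0 : B.coeff 0 = 1) (hAB : IsCoprime A B) :
    (A : ℂ⟦X⟧) * (B : ℂ⟦X⟧)⁻¹ ∈ padeClass p q := by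
  set f : ℂ⟦X⟧ := (A : ℂ⟦X⟧) * (B : ℂ⟦X⟧)⁻¹ with hf
  intro hdet
  -- A kernel vector gives `C ≠ 0` with `deg C ≤ q` and `C(0) = 0` for which `f * C` has no terms of
  -- index `p + 1, …, p + q`. With `D` its part of degree at most `p`, the polynomial `A * C - D *
  -- B` has degree at most `p + q` but vanishes to order `p + q + 1`.
  obtain ⟨x, hx, hHx⟩ := Matrix.exists_mulVec_eq_zero_iff.2 hdet
  set C := polynomialOfVec x with hC
  have hvec : (fun j : Fin q => C.coeff (q - j)) = x := funext (polynomialOfVec_coeff_sub x)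
  have hvan : ∀ i : Fin q, PowerSeries.coeff (p + 1 + i) (f * (C : ℂ⟦X⟧)) = 0 := fun i => by
    rw [coeff_mul_coe_eq_hankel_mulVec f p (natDegree_polynomialOfVec_le x), hvec, hHx,
      polynomialOfVec_coeff_zero]
    simp
  set D := PowerSeries.trunc (p + 1) (f * (C : ℂ⟦X⟧)) with hD
  have hfB : f * (B : ℂ⟦X⟧) = A := by
    rw [hf, mul_assoc, mul_comm _ (B : ℂ⟦X⟧), coe_mul_inv_cancel hB0, mul_one]
  have hdvd : (PowerSeries.X : ℂ⟦X⟧) ^ (p + q + 1) ∣ ((A * C - D * B : ℂ[X]) : ℂ⟦X⟧) := by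
    have h1 := (X_pow_dvd_sub_trunc hvan).mul_right (B : ℂ⟦X⟧)
    convert h1 using 1
    push_cast
    linear_combination -(C : ℂ⟦X⟧) * hfB
  have hdeg : (A * C - D * B).natDegree < p + q + 1 := by
    refine Nat.lt_succ_of_le ((Polynomial.natDegree_sub_le _ _).trans (max_le ?_ ?_))
    · exact Polynomial.natDegree_mul_le.trans (add_le_add hA (natDegree_polynomialOfVec_le x))
    · exact Polynomial.natDegree_mul_le.trans (add_le_add (natDegree_trunc_succ_le _ _) hB.le)
  have hAC : A * C = D * B := sub_eq_zero.1 (coe_eq_zero_of_X_pow_dvd hdeg hdvd)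
  have hBC : B ∣ C := hAB.symm.dvd_of_dvd_mul_left ⟨D, by rw [hAC, mul_comm]⟩
  obtain ⟨E, hE⟩ := hBC
  -- Exactness of `deg B = q ≥ deg C` forces the cofactor `E` to be constant, and `C(0) = 0` forces
  -- that constant to be `0`.
  have hE0 : E.coeff 0 = 0 := by
    have := polynomialOfVec_coeff_zero x
    rwa [← hC, hE, Polynomial.mul_coeff_zero, hB0, one_mul] at this
  have hBne : B ≠ 0 := by rintro rfl; simp at hB0
  have hEz : E = 0 := by
    by_contra hne
    have h1 : C.natDegree = q + E.natDegree := by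
      rw [hE, Polynomial.natDegree_mul hBne hne, hB]
    have h2 := natDegree_polynomialOfVec_le x
    rw [← hC] at h2
    have h3 := Polynomial.eq_C_of_natDegree_le_zero (p := E) (by lia)
    rw [hE0, map_zero] at h3
    exact hne h3
  apply hx
  rw [← hvec, hE, hEz]
  ext j
  simp

end Hankel

/-! ### Existence and uniqueness of Padé approximants -/

section Pade

/-- The solution of the linear system for the coefficients of the Padé denominator. -/
noncomputable def padeVec (f : ℂ⟦X⟧) (p q : ℕ) : Fin q → ℂ :=
  (hankel f p q).det⁻¹ • (hankel f p q).adjugate.mulVec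
    (fun i => -PowerSeries.coeff (p + 1 + i) f)

/-- The denominator of the Padé approximant of type `(p, q)` of a series in `padeClass p q`. -/
noncomputable def padeDen (f : ℂ⟦X⟧) (p q : ℕ) : ℂ[X] := polynomialOfVec (padeVec f p q) + 1

/-- The numerator of the Padé approximant of type `(p, q)` of a series in `padeClass p q`. -/
noncomputable def padeNum (f : ℂ⟦X⟧) (p q : ℕ) : ℂ[X] :=
  PowerSeries.trunc (p + 1) (f * (padeDen f p q : ℂ⟦X⟧))

theorem hankel_mulVec_eq_iff {f : ℂ⟦X⟧} {p q : ℕ} (hf : f ∈ padeClass p q) (x : Fin q → ℂ) :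
    (hankel f p q).mulVec x = (fun i : Fin q => -PowerSeries.coeff (p + 1 + i) f) ↔
      x = padeVec f p q := by
  have hdet : (hankel f p q).det ≠ 0 := hf
  constructor
  · intro h
    rw [padeVec, ← h, Matrix.mulVec_mulVec, Matrix.adjugate_mul, Matrix.smul_mulVec,
      Matrix.one_mulVec, inv_smul_smul₀ hdet]
  · rintro rfl
    rw [padeVec, Matrix.mulVec_smul, Matrix.mulVec_mulVec, Matrix.mul_adjugate,
      Matrix.smul_mulVec, Matrix.one_mulVec, inv_smul_smul₀ hdet]

theorem padeDen_coeff_zero (f : ℂ⟦X⟧) (p q : ℕ) : (padeDen f p q).coeff 0 = 1 := by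
  simp [padeDen, polynomialOfVec_coeff_zero]

theorem padeDen_coeff_sub (f : ℂ⟦X⟧) (p q : ℕ) (j : Fin q) :
    (padeDen f p q).coeff (q - j) = padeVec f p q j := by
  have hj := j.2
  rw [padeDen, Polynomial.coeff_add, polynomialOfVec_coeff_sub, Polynomial.coeff_one,
    if_neg (by lia), add_zero]

theorem natDegree_padeDen_le (f : ℂ⟦X⟧) (p q : ℕ) : (padeDen f p q).natDegree ≤ q :=
  (Polynomial.natDegree_add_le _ _).trans
    (max_le (natDegree_polynomialOfVec_le _) (by simp))

theorem isPadeApproximant_padeNum_padeDen {f : ℂ⟦X⟧} {p q : ℕ} (hf : f ∈ padeClass p q) :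
    IsPadeApproximant f p q (padeNum f p q) (padeDen f p q) where
  natDegree_num_le := natDegree_trunc_succ_le _ _
  natDegree_den_le := natDegree_padeDen_le f p q
  den_coeff_zero := padeDen_coeff_zero f p q
  coeff_eq := by
    rw [← X_pow_succ_dvd_sub_iff, X_pow_dvd_mul_inv_sub_iff (padeDen_coeff_zero f p q)]
    refine X_pow_dvd_sub_trunc fun i => ?_
    rw [coeff_mul_coe_eq_hankel_mulVec f p (natDegree_padeDen_le f p q), padeDen_coeff_zero,
      show (fun j : Fin q => (padeDen f p q).coeff (q - j)) = padeVec f p q from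
        funext (padeDen_coeff_sub f p q), (hankel_mulVec_eq_iff hf _).2 rfl]
    simp

/-- Since `deg A ≤ p`, the coefficients of `f * B` of index `p + 1, …, p + q` vanish; this is an
invertible Hankel system for the coefficients of `B`. -/
theorem IsPadeApproximant.eq_padeDen {f : ℂ⟦X⟧} {p q : ℕ} {A B : ℂ[X]}
    (h : IsPadeApproximant f p q A B) (hf : f ∈ padeClass p q) : B = padeDen f p q := by
  have hd := h.coeff_eq
  rw [← X_pow_succ_dvd_sub_iff, X_pow_dvd_mul_inv_sub_iff h.den_coeff_zero,
    X_pow_succ_dvd_sub_iff] at hd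
  have hx : (fun j : Fin q => B.coeff (q - j)) = padeVec f p q := by
    rw [← hankel_mulVec_eq_iff hf]
    ext i
    have h1 := hd (p + 1 + i) (by lia)
    rw [coeff_mul_coe_eq_hankel_mulVec f p h.natDegree_den_le, h.den_coeff_zero, mul_one,
      Polynomial.coeff_coe, Polynomial.coeff_eq_zero_of_natDegree_lt
        (by have := h.natDegree_num_le; lia)] at h1
    exact eq_neg_of_add_eq_zero_left h1
  ext k
  rcases Nat.eq_zero_or_pos k with rfl | hk
  · rw [h.den_coeff_zero, padeDen_coeff_zero]
  · by_cases hkq : k ≤ q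
    · have h1 := congrFun hx ⟨q - k, by lia⟩
      have h2 := padeDen_coeff_sub f p q ⟨q - k, by lia⟩
      simp only [show q - (q - k) = k by lia] at h1 h2
      rw [h1, h2]
    · rw [Polynomial.coeff_eq_zero_of_natDegree_lt (by have := h.natDegree_den_le; lia),
        Polynomial.coeff_eq_zero_of_natDegree_lt (by have := natDegree_padeDen_le f p q; lia)]

theorem IsPadeApproximant.eq_padeNum {f : ℂ⟦X⟧} {p q : ℕ} {A B : ℂ[X]}
    (h : IsPadeApproximant f p q A B) (hf : f ∈ padeClass p q) : A = padeNum f p q := by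
  have hd := h.coeff_eq
  rw [← X_pow_succ_dvd_sub_iff, X_pow_dvd_mul_inv_sub_iff h.den_coeff_zero,
    X_pow_succ_dvd_sub_iff, h.eq_padeDen hf] at hd
  ext k
  rw [padeNum, PowerSeries.coeff_trunc]
  split_ifs with hk
  · rw [hd k (by lia), Polynomial.coeff_coe]
  · exact Polynomial.coeff_eq_zero_of_natDegree_lt (by have := h.natDegree_num_le; lia)

theorem isExactPadeApproximant_of_isCoprime {A B : ℂ[X]} {p q : ℕ} (hA : A.natDegree = p)
    (hB : B.natDegree = q) (hB0 : B.coeff 0 = 1) (hA0 : A ≠ 0) :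
    IsExactPadeApproximant ((A : ℂ⟦X⟧) * (B : ℂ⟦X⟧)⁻¹) p q A B where
  natDegree_num_le := hA.le
  natDegree_den_le := hB.le
  den_coeff_zero := hB0
  coeff_eq := fun _ _ => rfl
  leadingCoeffs_ne_zero := by
    have hBne : B ≠ 0 := by rintro rfl; simp at hB0
    subst hA hB
    exact mul_ne_zero (Polynomial.leadingCoeff_ne_zero.2 hA0)
      (Polynomial.leadingCoeff_ne_zero.2 hBne)

end Pade

/-! ### Approximation with prescribed jet and exact degrees -/

/-- Rational approximation of `Q` on `K` with a prescribed jet at the origin. -/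
theorem HolomorphicNear.exists_rational_approx_with_jet {K : Set ℂ} (hK : IsCompact K)
    (h0 : (0 : ℂ) ∉ K) {Q : ℂ → ℂ} (hQ : HolomorphicNear Q K) (P : ℂ[X]) (N : ℕ) {ε : ℝ}
    (hε : 0 < ε) :
    ∃ A B : ℂ[X], B.coeff 0 = 1 ∧ Polynomial.X ^ N ∣ A - P * B ∧
      ∀ z ∈ K, B.eval z ≠ 0 ∧ ‖A.eval z / B.eval z - Q z‖ < ε := by
  obtain ⟨U, hU, hKU, hQU⟩ := hQ
  obtain ⟨r, hr, hrK⟩ := Metric.nhds_basis_closedBall.mem_iff.1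
    (hK.isClosed.isOpen_compl.mem_nhds h0)
  classical
  -- If `A / B` approximates `(Q - P) / z ^ N` on `K`, then `P + z ^ N * A / B` approximates `Q`
  -- there and has the jet of `P` at the origin. The point `0` is added to `K` only to have `B(0) ≠
  -- 0`; the value `0` of `G` near it is arbitrary.
  set G : ℂ → ℂ := fun z => if z ∈ Metric.closedBall (0 : ℂ) r then 0
    else (Q z - P.eval z) / z ^ N with hG
  have hGnear : HolomorphicNear G (insert 0 K) := by
    refine ⟨(U ∩ (Metric.closedBall 0 r)ᶜ) ∪ Metric.ball 0 r, ?_, ?_, ?_⟩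
    · exact (hU.inter Metric.isClosed_closedBall.isOpen_compl).union Metric.isOpen_ball
    · rintro z (rfl | hz)
      · exact Or.inr (Metric.mem_ball_self hr)
      · exact Or.inl ⟨hKU hz, fun h => hrK h hz⟩
    · rintro z (⟨hzU, hz⟩ | hz)
      · have hz0 : z ≠ 0 := by
          rintro rfl
          exact hz (Metric.mem_closedBall_self hr.le)
        have h1 : DifferentiableAt ℂ (fun z => (Q z - P.eval z) / z ^ N) z :=
          ((hQU.differentiableAt (hU.mem_nhds hzU)).sub P.differentiableAt).div
            (by fun_prop) (pow_ne_zero _ hz0)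
        refine (h1.congr_of_eventuallyEq ?_).differentiableWithinAt
        filter_upwards [Metric.isClosed_closedBall.isOpen_compl.mem_nhds hz] with w hw
        exact if_neg hw
      · refine ((differentiableAt_const (c := (0 : ℂ))).congr_of_eventuallyEq
          ?_).differentiableWithinAt
        filter_upwards [Metric.isOpen_ball.mem_nhds hz] with w hw
        exact if_pos (Metric.ball_subset_closedBall hw)
  obtain ⟨M, hM⟩ := hK.exists_bound_of_continuousOn (f := fun z : ℂ => z ^ N) (by fun_prop)
  have hM1 : 0 < |M| + 1 := by positivity
  obtain ⟨A, B, hAB⟩ := hGnear.exists_rational_approx (hK.insert 0) (div_pos hε hM1)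
  have hB0 : B.coeff 0 ≠ 0 := by
    rw [Polynomial.coeff_zero_eq_eval_zero]
    exact (hAB 0 (Set.mem_insert _ _)).1
  set c := (B.coeff 0)⁻¹ with hc
  have hc0 : c ≠ 0 := inv_ne_zero hB0
  refine ⟨P * (Polynomial.C c * B) + Polynomial.X ^ N * (Polynomial.C c * A),
    Polynomial.C c * B, by simp [hc, hB0], ⟨Polynomial.C c * A, by ring⟩, fun z hz => ?_⟩
  obtain ⟨hBz, hlt⟩ := hAB z (Set.mem_insert_of_mem _ hz)
  have hz0 : z ≠ 0 := fun h => h0 (h ▸ hz)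
  refine ⟨by simp [hc0, hBz], ?_⟩
  have hGz : G z = (Q z - P.eval z) / z ^ N := if_neg fun h => hrK h hz
  have heq : (P * (Polynomial.C c * B) + Polynomial.X ^ N * (Polynomial.C c * A)).eval z /
      (Polynomial.C c * B).eval z - Q z = z ^ N * (A.eval z / B.eval z - G z) := by
    rw [hGz]
    simp only [Polynomial.eval_add, Polynomial.eval_mul, Polynomial.eval_pow, Polynomial.eval_X,
      Polynomial.eval_C]
    field_simp
    ring
  rw [heq, norm_mul]
  calc ‖z ^ N‖ * ‖A.eval z / B.eval z - G z‖
      ≤ |M| * ‖A.eval z / B.eval z - G z‖ := by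
        gcongr
        exact (hM z hz).trans (le_abs_self M)
    _ ≤ (|M| + 1) * ‖A.eval z / B.eval z - G z‖ := by gcongr; linarith
    _ < (|M| + 1) * (ε / (|M| + 1)) := by gcongr
    _ = ε := by field_simp

/-- A fraction without poles on `K` can be perturbed to a reduced one whose numerator and
denominator have prescribed large exact degrees. -/
theorem exists_isCoprime_approx {K : Set ℂ} (hK : IsCompact K) {A B : ℂ[X]} (hB0 : B.coeff 0 = 1)
    (hBK : ∀ z ∈ K, B.eval z ≠ 0) {p q : ℕ} (hq : B.natDegree ≤ q) (hp : A.natDegree + q < p)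
    {ε : ℝ} (hε : 0 < ε) :
    ∃ A' B' : ℂ[X], A'.natDegree = p ∧ B'.natDegree = q ∧ B'.coeff 0 = 1 ∧ IsCoprime A' B' ∧
      Polynomial.X ^ p ∣ A' * B - A * B' ∧
      ∀ z ∈ K, B'.eval z ≠ 0 ∧ ‖A'.eval z / B'.eval z - A.eval z / B.eval z‖ < ε := by
  obtain ⟨R, hR⟩ := hK.isBounded.subset_ball (0 : ℂ)
  set η : ℂ := ((|R| + 1 : ℝ) : ℂ)⁻¹ with hη
  have hR1 : (0 : ℝ) < |R| + 1 := by positivity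
  have hη0 : η ≠ 0 := by
    rw [hη]
    exact inv_ne_zero (by exact_mod_cast hR1.ne')
  -- The only zero of `L` is `|R| + 1`, outside `K`. Multiplying `A` and `B` by `L ^ k` raises the
  -- degree of the denominator to `q` and leaves the fraction unchanged on `K`.
  set L : ℂ[X] := Polynomial.C (-η) * Polynomial.X + Polynomial.C 1 with hL
  have hLd : L.natDegree = 1 := Polynomial.natDegree_linear (neg_ne_zero.2 hη0)
  have hLK : ∀ z ∈ K, L.eval z ≠ 0 := fun z hz h => by
    have h1 : ‖z‖ < R := mem_ball_zero_iff.1 (hR hz)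
    have h2 : η * z = 1 := by
      simp only [hL, Polynomial.eval_add, Polynomial.eval_mul, Polynomial.eval_C,
        Polynomial.eval_X] at h
      linear_combination -h
    have h3 : z = ((|R| + 1 : ℝ) : ℂ) := by
      rw [hη] at h2
      have : ((|R| + 1 : ℝ) : ℂ) ≠ 0 := by exact_mod_cast hR1.ne'
      field_simp at h2
      exact h2
    rw [h3, Complex.norm_real, Real.norm_eq_abs, abs_of_pos hR1] at h1
    linarith [le_abs_self R]
  set k := q - B.natDegree with hk
  have hBne : B ≠ 0 := by rintro rfl; simp at hB0
  have hLne : L ≠ 0 := by intro h; simp [h] at hLd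
  set B' := B * L ^ k with hB'
  have hB'd : B'.natDegree = q := by
    rw [hB', Polynomial.natDegree_mul hBne (pow_ne_zero _ hLne), Polynomial.natDegree_pow, hLd]
    lia
  have hB'0 : B'.coeff 0 = 1 := by
    rw [hB', Polynomial.mul_coeff_zero, hB0, Polynomial.coeff_zero_eq_eval_zero]
    simp [hL]
  have hB'ne : B' ≠ 0 := by intro h; simp [h] at hB'0
  have hB'K : ∀ z ∈ K, B'.eval z ≠ 0 := fun z hz => by
    simp [hB', hBK z hz, hLK z hz]
  obtain ⟨M, hM⟩ := hK.exists_bound_of_continuousOn (f := fun z : ℂ => z ^ p / B'.eval z)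
    (ContinuousOn.div (by fun_prop) B'.continuousOn hB'K)
  have hM1 : 0 < |M| + 1 := by positivity
  -- Adding `c * X ^ p` to the numerator gives it degree `p` if `c ≠ 0`. Each zero `β` of `B'` is
  -- nonzero, so it is a common zero for exactly one value of `c`; any small `c` outside this finite
  -- set works.
  set bad : Finset ℂ := insert 0 (B'.roots.toFinset.image
    fun β => -((A * L ^ k).eval β) / β ^ p) with hbad
  obtain ⟨c, hcball, hcbad⟩ := (infinite_of_mem_nhds (0 : ℂ)
    (Metric.ball_mem_nhds _ (div_pos hε hM1))).exists_notMem_finset bad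
  have hc0 : c ≠ 0 := by rintro rfl; simp [hbad] at hcbad
  have hcε : ‖c‖ < ε / (|M| + 1) := by simpa using hcball
  have hALd : (A * L ^ k).natDegree < p := by
    refine lt_of_le_of_lt (Polynomial.natDegree_mul_le.trans
      (Nat.add_le_add_left Polynomial.natDegree_pow_le _)) ?_
    rw [hLd]
    lia
  refine ⟨A * L ^ k + Polynomial.C c * Polynomial.X ^ p, B', ?_, hB'd, hB'0, ?_,
    ⟨Polynomial.C c * B, by rw [hB']; ring⟩, fun z hz => ⟨hB'K z hz, ?_⟩⟩
  · rw [Polynomial.natDegree_add_eq_right_of_natDegree_lt, Polynomial.natDegree_C_mul_X_pow _ _ hc0]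
    rwa [Polynomial.natDegree_C_mul_X_pow _ _ hc0]
  · refine (Polynomial.isCoprime_iff_aeval_ne_zero_of_isAlgClosed ℂ ℂ _ _).2 fun β => ?_
    by_contra! hcon
    simp only [Polynomial.coe_aeval_eq_eval] at hcon
    obtain ⟨h1, h2⟩ := hcon
    have hβ0 : β ≠ 0 := by
      rintro rfl
      rw [← Polynomial.coeff_zero_eq_eval_zero, hB'0] at h2
      exact one_ne_zero h2
    apply hcbad
    refine Finset.mem_insert_of_mem (Finset.mem_image.2 ⟨β, ?_, ?_⟩)
    · rw [Multiset.mem_toFinset, Polynomial.mem_roots hB'ne]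
      exact h2
    · rw [div_eq_iff (pow_ne_zero _ hβ0)]
      simp only [Polynomial.eval_add, Polynomial.eval_mul, Polynomial.eval_C, Polynomial.eval_pow,
        Polynomial.eval_X] at h1 ⊢
      linear_combination -h1
  · have hBz := hBK z hz
    have hLz := hLK z hz
    have heq : (A * L ^ k + Polynomial.C c * Polynomial.X ^ p).eval z / B'.eval z -
        A.eval z / B.eval z = c * (z ^ p / B'.eval z) := by
      simp only [hB', Polynomial.eval_add, Polynomial.eval_mul, Polynomial.eval_C,
        Polynomial.eval_pow, Polynomial.eval_X]
      field_simp
      ring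
    rw [heq, norm_mul]
    calc ‖c‖ * ‖z ^ p / B'.eval z‖ ≤ ‖c‖ * (|M| + 1) := by
          gcongr
          linarith [hM z hz, le_abs_self M]
      _ < ε / (|M| + 1) * (|M| + 1) := by gcongr
      _ = ε := by field_simp

/-- Under condition (H) every series agrees to any given order with the Taylor series of a
reduced fraction whose exact degrees lie in `J` and which approximates `Q` on `K`. -/
theorem ConditionH.exists_isExactPadeApproximant {J : Set (ℕ × ℕ)} (hJ : ConditionH J) {K : Set ℂ}
    (hK : IsCompact K) (h0 : (0 : ℂ) ∉ K) {Q : ℂ → ℂ} (hQ : HolomorphicNear Q K) (f₀ : ℂ⟦X⟧)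
    (N : ℕ) {ε : ℝ} (hε : 0 < ε) :
    ∃ (f : ℂ⟦X⟧) (p q : ℕ) (A B : ℂ[X]),
      (∀ v < N, PowerSeries.coeff v f = PowerSeries.coeff v f₀) ∧ (p, q) ∈ J ∧
      f ∈ padeClass p q ∧ IsExactPadeApproximant f p q A B ∧
      ∀ z ∈ K, B.eval z ≠ 0 ∧ ‖A.eval z / B.eval z - Q z‖ < ε := by
  set P := PowerSeries.trunc N f₀ with hP
  obtain ⟨A, B, hB0, hdvd, hAB⟩ := hQ.exists_rational_approx_with_jet hK h0 P N (half_pos hε)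
  obtain ⟨p, q, hpq, hq, hpmq⟩ := hJ
  -- The bounds `q n ≥ deg B` and `p n - q n > deg A` leave room for both degree adjustments. From
  -- `p n > q n ≥ N` the perturbation, of order `p n` at the origin, leaves the jet of order `N`
  -- intact.
  obtain ⟨n, ⟨hn1, hn2⟩, hn3⟩ := ((hq.eventually_ge_atTop B.natDegree).and
    (hq.eventually_ge_atTop N) |>.and (hpmq.eventually_gt_atTop (A.natDegree : ℤ))).exists
  obtain ⟨A', B', hA', hB', hB'0, hcop, hdvd', hAB'⟩ := exists_isCoprime_approx hK hB0
    (fun z hz => (hAB z hz).1) hn1 (show A.natDegree + q n < p n by lia) (half_pos hε)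
  have hA'0 : A' ≠ 0 := by
    rintro rfl
    rw [Polynomial.natDegree_zero] at hA'
    lia
  refine ⟨(A' : ℂ⟦X⟧) * (B' : ℂ⟦X⟧)⁻¹, p n, q n, A', B', ?_, hpq n,
    mem_padeClass_of_isCoprime hA'.le hB' hB'0 hcop,
    isExactPadeApproximant_of_isCoprime hA' hB' hB'0 hA'0, fun z hz => ⟨(hAB' z hz).1, ?_⟩⟩
  · have h1 : (PowerSeries.X : ℂ⟦X⟧) ^ N ∣ f₀ - P := by
      rw [PowerSeries.X_pow_dvd_iff]
      intro m hm
      simp [hP, PowerSeries.coeff_trunc, hm]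
    have h2 : (PowerSeries.X : ℂ⟦X⟧) ^ N ∣ (A : ℂ⟦X⟧) - P * B := by
      have := map_dvd (Polynomial.coeToPowerSeries.ringHom (R := ℂ)) hdvd
      simpa using this
    have h3 : (PowerSeries.X : ℂ⟦X⟧) ^ N ∣ (A' : ℂ⟦X⟧) * B - A * B' := by
      have := map_dvd (Polynomial.coeToPowerSeries.ringHom (R := ℂ))
        ((pow_dvd_pow Polynomial.X (show N ≤ p n by lia)).trans hdvd')
      simpa using this
    have h4 : (PowerSeries.X : ℂ⟦X⟧) ^ N ∣ (A' : ℂ⟦X⟧) * (B' : ℂ⟦X⟧)⁻¹ - f₀ := by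
      have hBi := coe_mul_inv_cancel hB0
      have hBi' := coe_mul_inv_cancel hB'0
      -- This is `(A'/B' - A/B) + (A/B - P) + (P - f₀)`.
      have e : (A' : ℂ⟦X⟧) * (B' : ℂ⟦X⟧)⁻¹ - f₀ =
          (A' * B - A * B') * ((B : ℂ⟦X⟧)⁻¹ * (B' : ℂ⟦X⟧)⁻¹) + (A - P * B) * (B : ℂ⟦X⟧)⁻¹ +
            (f₀ - P) * (-1) := by
        linear_combination -(A' : ℂ⟦X⟧) * (B' : ℂ⟦X⟧)⁻¹ * hBi + (A : ℂ⟦X⟧) * (B : ℂ⟦X⟧)⁻¹ * hBi' +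
          P * hBi
      rw [e]
      exact dvd_add (dvd_add (h3.mul_right _) (h2.mul_right _)) (h1.mul_right _)
    intro v hv
    have := PowerSeries.X_pow_dvd_iff.1 h4 v hv
    rwa [map_sub, sub_eq_zero] at this
  · calc ‖A'.eval z / B'.eval z - Q z‖
        = ‖(A'.eval z / B'.eval z - A.eval z / B.eval z) + (A.eval z / B.eval z - Q z)‖ := by
          congr 1; ring
      _ ≤ _ := norm_add_le _ _
      _ < ε / 2 + ε / 2 := add_lt_add (hAB' z hz).2 (hAB z hz).2
      _ = ε := add_halves ε

/-! ### Completeness and density for the ring metric -/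

section RingMetric

theorem coeff_eq_of_ringDist_lt {f g : ℂ⟦X⟧} {n : ℕ} (h : ringDist f g < (1 / 2 : ℝ) ^ n) {v : ℕ}
    (hv : v ≤ n) : PowerSeries.coeff v f = PowerSeries.coeff v g := by
  by_contra hne
  have hfg : f ≠ g := fun e => hne (e ▸ rfl)
  rw [ringDist, if_neg hfg] at h
  exact h.not_ge (pow_le_pow_of_le_one (by norm_num) (by norm_num) ((Nat.sInf_le hne).trans hv))

theorem ringDist_le_of_coeff_eq {f g : ℂ⟦X⟧} {n : ℕ}
    (h : ∀ v < n, PowerSeries.coeff v f = PowerSeries.coeff v g) :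
    ringDist f g ≤ (1 / 2 : ℝ) ^ n := by
  unfold ringDist
  split_ifs with hfg
  · positivity
  · refine pow_le_pow_of_le_one (by norm_num) (by norm_num) ?_
    refine le_csInf ?_ fun k hk => not_lt.1 fun hlt => hk (h k hlt)
    by_contra hemp
    exact hfg (PowerSeries.ext fun k => by_contra fun hk => hemp ⟨k, hk⟩)

/-- Along a Cauchy sequence every coefficient is eventually constant; the limit collects the final
values. -/
theorem completeSpace_ringMetric : @CompleteSpace ℂ⟦X⟧ ringMetric.toUniformSpace := by
  let := ringMetric
  refine Metric.complete_of_cauchySeq_tendsto fun u hu => ?_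
  have hpow : ∀ n : ℕ, (0 : ℝ) < (1 / 2 : ℝ) ^ n := fun n => by positivity
  choose N hN using fun n : ℕ => Metric.cauchySeq_iff'.1 hu _ (hpow n)
  have hstab : ∀ n m v, N n ≤ m → v ≤ n →
      PowerSeries.coeff v (u m) = PowerSeries.coeff v (u (N n)) := fun n m v hm hv =>
    coeff_eq_of_ringDist_lt (hN n m hm) hv
  refine ⟨PowerSeries.mk fun n => PowerSeries.coeff n (u (N n)), Metric.tendsto_atTop.2 ?_⟩
  intro ε hε
  obtain ⟨n, hn⟩ := exists_pow_lt_of_lt_one hε (show (1 / 2 : ℝ) < 1 by norm_num)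
  refine ⟨N n, fun m hm => lt_of_le_of_lt (ringDist_le_of_coeff_eq fun v hv => ?_) hn⟩
  rw [PowerSeries.coeff_mk, hstab n m v hm hv.le]
  -- The limit reads coefficient `v` at stage `N v`, not `N n`; both agree with a common later
  -- stage.
  rw [← hstab n (max (N n) (N v)) v (le_max_left _ _) hv.le,
    hstab v (max (N n) (N v)) v (le_max_right _ _) le_rfl]

theorem continuous_coeff_ringTopology (n : ℕ) :
    @Continuous _ _ ringTopology _ fun f : ℂ⟦X⟧ => PowerSeries.coeff n f := by
  let := ringMetric
  refine continuous_iff_continuousAt.2 fun f => ?_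
  refine (continuousAt_const (y := PowerSeries.coeff n f)).congr ?_
  filter_upwards [Metric.ball_mem_nhds f (show (0 : ℝ) < (1 / 2 : ℝ) ^ n by positivity)] with g hg
  exact (coeff_eq_of_ringDist_lt (Metric.mem_ball.1 hg) le_rfl).symm

theorem continuous_coeff_cartesianTopology (n : ℕ) :
    @Continuous _ _ cartesianTopology _ fun f : ℂ⟦X⟧ => PowerSeries.coeff n f := by
  let := cartesianTopology
  have h : Continuous fun (f : ℂ⟦X⟧) (n : ℕ) => PowerSeries.coeff n f := continuous_induced_dom
  exact continuous_pi_iff.1 h n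

theorem ringTopology_le_cartesianTopology : ringTopology ≤ cartesianTopology := by
  refine continuous_iff_le_induced.1 ?_
  let := ringTopology
  exact continuous_pi continuous_coeff_ringTopology

theorem dense_ringTopology_of_forall {S : Set ℂ⟦X⟧}
    (h : ∀ (f₀ : ℂ⟦X⟧) (N : ℕ), ∃ f ∈ S, ∀ v < N, PowerSeries.coeff v f = PowerSeries.coeff v f₀) :
    @Dense ℂ⟦X⟧ ringTopology S := by
  let := ringMetric
  refine Metric.dense_iff.2 fun f₀ r hr => ?_
  obtain ⟨n, hn⟩ := exists_pow_lt_of_lt_one hr (show (1 / 2 : ℝ) < 1 by norm_num)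
  obtain ⟨f, hf, hff⟩ := h f₀ n
  exact ⟨f, Metric.mem_ball.2 ((ringDist_le_of_coeff_eq hff).trans_lt hn), hf⟩

end RingMetric

/-! ### Continuity of Padé approximants in any topology with continuous coefficients -/

section Continuity

variable [TopologicalSpace ℂ⟦X⟧]

theorem continuous_intCoeff (hc : ∀ n, Continuous fun f : ℂ⟦X⟧ => PowerSeries.coeff n f) (k : ℤ) :
    Continuous fun f : ℂ⟦X⟧ => intCoeff f k := by
  unfold intCoeff
  split_ifs
  · exact hc _
  · exact continuous_const

theorem continuous_hankel (hc : ∀ n, Continuous fun f : ℂ⟦X⟧ => PowerSeries.coeff n f) (p q : ℕ) :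
    Continuous fun f : ℂ⟦X⟧ => hankel f p q :=
  continuous_matrix fun _ _ => continuous_intCoeff hc _

theorem isOpen_padeClass (hc : ∀ n, Continuous fun f : ℂ⟦X⟧ => PowerSeries.coeff n f) (p q : ℕ) :
    IsOpen (padeClass p q) :=
  isOpen_ne.preimage (continuous_hankel hc p q).matrix_det

/-- The determinant and the adjugate are polynomial in the coefficients of `f`, so division by the
nonzero determinant is the only delicate step. -/
theorem continuousAt_padeVec (hc : ∀ n, Continuous fun f : ℂ⟦X⟧ => PowerSeries.coeff n f)
    {p q : ℕ} {f : ℂ⟦X⟧} (hf : f ∈ padeClass p q) :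
    ContinuousAt (fun f : ℂ⟦X⟧ => padeVec f p q) f := by
  have hH := continuous_hankel hc p q
  refine ContinuousAt.smul (hH.matrix_det.continuousAt.inv₀ hf) (Continuous.continuousAt ?_)
  exact hH.matrix_adjugate.matrix_mulVec (continuous_pi fun i => (hc _).neg)

theorem continuousAt_padeDen_coeff (hc : ∀ n, Continuous fun f : ℂ⟦X⟧ => PowerSeries.coeff n f)
    {p q : ℕ} {f : ℂ⟦X⟧} (hf : f ∈ padeClass p q) (k : ℕ) :
    ContinuousAt (fun f : ℂ⟦X⟧ => (padeDen f p q).coeff k) f := by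
  simp only [padeDen, polynomialOfVec, Polynomial.coeff_add, Polynomial.finsetSum_coeff,
    Polynomial.coeff_C_mul]
  refine ContinuousAt.add (tendsto_finsetSum _ fun j _ => ?_) continuousAt_const
  exact ((continuous_apply j).continuousAt.comp (continuousAt_padeVec hc hf)).mul
    continuousAt_const

theorem continuousAt_padeNum_coeff (hc : ∀ n, Continuous fun f : ℂ⟦X⟧ => PowerSeries.coeff n f)
    {p q : ℕ} {f : ℂ⟦X⟧} (hf : f ∈ padeClass p q) (k : ℕ) :
    ContinuousAt (fun f : ℂ⟦X⟧ => (padeNum f p q).coeff k) f := by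
  simp only [padeNum, PowerSeries.coeff_trunc,
    coeff_mul_coe_eq_sum_range _ (natDegree_padeDen_le _ p q)]
  split_ifs
  · exact tendsto_finsetSum _ fun j _ =>
      (continuous_intCoeff hc _).continuousAt.mul (continuousAt_padeDen_coeff hc hf j)
  · exact continuousAt_const

/-- The degree bound turns evaluation into a sum of fixed length. Continuity is joint in series and
point, as the compactness argument of `isOpen_padeNear` needs. -/
theorem continuousAt_eval_of_coeff {F : ℂ⟦X⟧ → ℂ[X]} {d : ℕ} (hd : ∀ f, (F f).natDegree ≤ d)
    {f : ℂ⟦X⟧} (hF : ∀ k, ContinuousAt (fun f => (F f).coeff k) f) (z : ℂ) :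
    ContinuousAt (fun x : ℂ⟦X⟧ × ℂ => (F x.1).eval x.2) (f, z) := by
  simp only [fun x : ℂ⟦X⟧ × ℂ =>
    Polynomial.eval_eq_sum_range' (Nat.lt_succ_of_le (hd x.1)) x.2]
  refine tendsto_finsetSum _ fun k _ => ?_
  exact (ContinuousAt.comp' (f := Prod.fst) (x := (f, z)) (hF k) continuousAt_fst).mul
    (continuousAt_snd.pow k)

end Continuity

/-! ### The open dense sets -/

/-- The series in `padeClass p q` whose Padé approximant of type `(p, q)` has no poles on `K`,
approximates `Q` on `K` up to `ε` and, if `e` holds, has exact degrees. -/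
def padeNear (e : Prop) (p q : ℕ) (K : Set ℂ) (Q : ℂ → ℂ) (ε : ℝ) : Set ℂ⟦X⟧ :=
  {f | f ∈ padeClass p q ∧ (e → (padeNum f p q).coeff p * (padeDen f p q).coeff q ≠ 0) ∧
    ∀ z ∈ K, (padeDen f p q).eval z ≠ 0 ∧
      ‖(padeNum f p q).eval z / (padeDen f p q).eval z - Q z‖ < ε}

/-- Nonvanishing and strict inequalities persist near each point of `{f} × K`; compactness of `K`
then yields one neighbourhood of `f` for all `z ∈ K`. -/
theorem isOpen_padeNear [TopologicalSpace ℂ⟦X⟧]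
    (hc : ∀ n, Continuous fun f : ℂ⟦X⟧ => PowerSeries.coeff n f) (e : Prop) (p q : ℕ)
    {K : Set ℂ} (hK : IsCompact K) {Q : ℂ → ℂ} (hQ : HolomorphicNear Q K) (ε : ℝ) :
    IsOpen (padeNear e p q K Q ε) := by
  obtain ⟨U, hU, hKU, hQU⟩ := hQ
  refine isOpen_iff_mem_nhds.2 fun f ⟨hf, hfe, hfK⟩ => ?_
  have h1 : ∀ᶠ g in 𝓝 f, g ∈ padeClass p q := (isOpen_padeClass hc p q).mem_nhds hf
  have h2 : ∀ᶠ g in 𝓝 f, e → (padeNum g p q).coeff p * (padeDen g p q).coeff q ≠ 0 := by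
    by_cases he : e
    · filter_upwards [((continuousAt_padeNum_coeff hc hf p).mul
        (continuousAt_padeDen_coeff hc hf q)).eventually_ne (hfe he)] with g hg _ using hg
    · exact Eventually.of_forall fun _ h => absurd h he
  have h3 : ∀ᶠ g in 𝓝 f, ∀ z ∈ K, (padeDen g p q).eval z ≠ 0 ∧
      ‖(padeNum g p q).eval z / (padeDen g p q).eval z - Q z‖ < ε := by
    refine hK.eventually_forall_of_forall_eventually fun z hz => ?_
    have hn := continuousAt_eval_of_coeff (F := fun g => padeNum g p q)
      (fun g => natDegree_trunc_succ_le _ _) (continuousAt_padeNum_coeff hc hf) z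
    have hd := continuousAt_eval_of_coeff (F := fun g => padeDen g p q)
      (fun g => natDegree_padeDen_le g p q) (continuousAt_padeDen_coeff hc hf) z
    have hQz : ContinuousAt Q z := (hQU.differentiableAt (hU.mem_nhds (hKU hz))).continuousAt
    have hQ' : ContinuousAt (fun x : ℂ⟦X⟧ × ℂ => Q x.2) (f, z) :=
      ContinuousAt.comp' (f := Prod.snd) (x := (f, z)) hQz continuousAt_snd
    exact (hd.eventually_ne (hfK z hz).1).and
      (((hn.div hd (hfK z hz).1).sub hQ').norm.eventually_lt continuousAt_const (hfK z hz).2)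
  filter_upwards [h1, h2, h3] with g hg1 hg2 hg3 using ⟨hg1, hg2, hg3⟩

/-- The series having, for some index pair in `J`, a Padé approximant as in `padeNear`. -/
def padeApprox (e : Prop) (J : Set (ℕ × ℕ)) (K : Set ℂ) (Q : ℂ → ℂ) (ε : ℝ) : Set ℂ⟦X⟧ :=
  ⋃ i ∈ J, padeNear e i.1 i.2 K Q ε

theorem isOpen_padeApprox [TopologicalSpace ℂ⟦X⟧]
    (hc : ∀ n, Continuous fun f : ℂ⟦X⟧ => PowerSeries.coeff n f) (e : Prop) (J : Set (ℕ × ℕ))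
    {K : Set ℂ} (hK : IsCompact K) {Q : ℂ → ℂ} (hQ : HolomorphicNear Q K) (ε : ℝ) :
    IsOpen (padeApprox e J K Q ε) :=
  isOpen_biUnion fun _ _ => isOpen_padeNear hc e _ _ hK hQ ε

theorem dense_padeApprox (e : Prop) {J : Set (ℕ × ℕ)} (hJ : ConditionH J) {K : Set ℂ}
    (hK : IsCompact K) (h0 : (0 : ℂ) ∉ K) {Q : ℂ → ℂ} (hQ : HolomorphicNear Q K) {ε : ℝ}
    (hε : 0 < ε) : @Dense ℂ⟦X⟧ ringTopology (padeApprox e J K Q ε) := by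
  refine dense_ringTopology_of_forall fun f₀ N => ?_
  obtain ⟨f, p, q, A, B, hff, hpq, hf, hAB, hK'⟩ :=
    hJ.exists_isExactPadeApproximant hK h0 hQ f₀ N hε
  refine ⟨f, Set.mem_biUnion hpq ⟨hf, fun _ => ?_, ?_⟩, hff⟩
  · rw [← hAB.eq_padeNum hf, ← hAB.eq_padeDen hf]
    exact hAB.leadingCoeffs_ne_zero
  · rwa [← hAB.eq_padeNum hf, ← hAB.eq_padeDen hf]

theorem mem_padeApprox_iff {e : Prop} {J : Set (ℕ × ℕ)} {K : Set ℂ} {Q : ℂ → ℂ} {ε : ℝ}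
    {f : ℂ⟦X⟧} : f ∈ padeApprox e J K Q ε ↔
      ∃ (p q : ℕ) (A B : ℂ[X]), (p, q) ∈ J ∧ f ∈ padeClass p q ∧ IsPadeApproximant f p q A B ∧
        (e → A.coeff p * B.coeff q ≠ 0) ∧
        ∀ z ∈ K, B.eval z ≠ 0 ∧ ‖A.eval z / B.eval z - Q z‖ < ε := by
  constructor
  · intro h
    obtain ⟨⟨p, q⟩, hpq, hf, he, hK⟩ := Set.mem_iUnion₂.1 h
    exact ⟨p, q, _, _, hpq, hf, isPadeApproximant_padeNum_padeDen hf, he, hK⟩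
  · rintro ⟨p, q, A, B, hpq, hf, hAB, he, hK⟩
    rw [hAB.eq_padeNum hf, hAB.eq_padeDen hf] at he hK
    exact Set.mem_biUnion hpq ⟨hf, he, hK⟩

/-- The common form of `padeUniversal` (`e` false) and `exactPadeUniversal` (`e` true). -/
def padeUniversalWith (e : Prop) (J : Set (ℕ × ℕ)) : Set ℂ⟦X⟧ :=
  {f | ∀ K : Set ℂ, IsCompact K → (0 : ℂ) ∉ K → ∀ Q : ℂ → ℂ, HolomorphicNear Q K →
    ∀ ε > 0, f ∈ padeApprox e J K Q ε}

/-- Nothing requires the index pairs of the sequence to be distinct or to grow, so choosing one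
approximant for each tolerance `1 / (n + 1)` is enough. -/
theorem exists_rationalTendstoUniformlyOn_iff (e : Prop) (J : Set (ℕ × ℕ)) (K : Set ℂ)
    (Q : ℂ → ℂ) (f : ℂ⟦X⟧) :
    (∀ ε > 0, f ∈ padeApprox e J K Q ε) ↔
      ∃ (p q : ℕ → ℕ) (A B : ℕ → ℂ[X]), (∀ n, (p n, q n) ∈ J) ∧
        (∀ n, f ∈ padeClass (p n) (q n)) ∧ (∀ n, IsPadeApproximant f (p n) (q n) (A n) (B n)) ∧
        (∀ n, e → (A n).coeff (p n) * (B n).coeff (q n) ≠ 0) ∧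
        RationalTendstoUniformlyOn A B Q K := by
  simp only [mem_padeApprox_iff]
  constructor
  · intro h
    choose p q A B h1 h2 h3 h4 h5 using fun n : ℕ => h (1 / ((n : ℝ) + 1)) Nat.one_div_pos_of_nat
    refine ⟨p, q, A, B, h1, h2, h3, h4, fun n z hz => (h5 n z hz).1,
      Metric.tendstoUniformlyOn_iff.2 fun ε hε => ?_⟩
    filter_upwards [tendsto_one_div_add_atTop_nhds_zero_nat.eventually_lt_const hε] with n hn z hz
    rw [dist_comm, dist_eq_norm]
    exact (h5 n z hz).2.trans hn
  · rintro ⟨p, q, A, B, h1, h2, h3, h4, h5, h6⟩ ε hε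
    obtain ⟨n, hn⟩ := (Metric.tendstoUniformlyOn_iff.1 h6 ε hε).exists
    refine ⟨p n, q n, A n, B n, h1 n, h2 n, h3 n, h4 n, fun z hz => ⟨h5 n z hz, ?_⟩⟩
    have := hn z hz
    rwa [dist_comm, dist_eq_norm] at this

theorem padeUniversal_eq (J : Set (ℕ × ℕ)) : padeUniversal J = padeUniversalWith False J := by
  ext f
  simp only [padeUniversal, padeUniversalWith, exists_rationalTendstoUniformlyOn_iff,
    Set.mem_ofPred_eq, false_imp_iff, implies_true, true_and]

theorem exactPadeUniversal_eq (J : Set (ℕ × ℕ)) :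
    exactPadeUniversal J = padeUniversalWith True J := by
  have h : ∀ f p q A B, IsExactPadeApproximant f p q A B ↔
      IsPadeApproximant f p q A B ∧ A.coeff p * B.coeff q ≠ 0 := fun f p q A B =>
    ⟨fun h => ⟨h.toIsPadeApproximant, h.leadingCoeffs_ne_zero⟩, fun h => ⟨h.1, h.2⟩⟩
  ext f
  simp only [exactPadeUniversal, padeUniversalWith, exists_rationalTendstoUniformlyOn_iff,
    Set.mem_ofPred_eq, true_imp_iff, h, forall_and, and_assoc]

/-! ### Reduction to countably many conditions and Baire's theorem -/

/-- A countable family of compact sets avoiding `0` which interpolates between the compact sets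
avoiding `0` and their neighbourhoods. -/
theorem exists_countable_compacts_between :
    ∃ 𝒦 : Set (Set ℂ), 𝒦.Countable ∧ (∀ L ∈ 𝒦, IsCompact L ∧ (0 : ℂ) ∉ L) ∧
      ∀ K U : Set ℂ, IsCompact K → (0 : ℂ) ∉ K → IsOpen U → K ⊆ U →
        ∃ L ∈ 𝒦, K ⊆ L ∧ L ⊆ U := by
  -- The family consists of closures of finite unions from a countable basis, filtered by
  -- compactness and by avoiding `0`.
  set 𝒮 : Set (Set (Set ℂ)) := {s | s.Finite ∧ s ⊆ TopologicalSpace.countableBasis ℂ} with h𝒮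
  have hcount : 𝒮.Countable :=
    Set.countable_ofPred_finite_subset (TopologicalSpace.countable_countableBasis ℂ)
  refine ⟨(fun s => closure (⋃₀ s)) '' 𝒮 ∩ {L | IsCompact L ∧ (0 : ℂ) ∉ L},
    (hcount.image _).mono Set.inter_subset_left, fun L hL => hL.2, ?_⟩
  intro K U hK h0 hU hKU
  obtain ⟨t, ht, hKt, htU⟩ := exists_compact_between hK (hU.sdiff (isClosed_singleton (x := (0 : ℂ))))
    (Set.subset_sdiff_singleton hKU h0)
  choose! b hb hxb hbt using fun x (hx : x ∈ K) =>
    (TopologicalSpace.isBasis_countableBasis ℂ).exists_subset_of_mem_open (hKt hx) isOpen_interior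
  obtain ⟨s, hs, hKs⟩ := hK.elim_nhds_subcover b fun x hx =>
    (TopologicalSpace.isOpen_of_mem_countableBasis (hb x hx)).mem_nhds (hxb x hx)
  have hsub : closure (⋃₀ (b '' (s : Set ℂ))) ⊆ t := by
    refine closure_minimal (Set.sUnion_subset ?_) ht.isClosed
    rintro _ ⟨x, hx, rfl⟩
    exact (hbt x (hs x hx)).trans interior_subset
  refine ⟨_, ⟨⟨b '' (s : Set ℂ), ⟨s.finite_toSet.image _, ?_⟩, rfl⟩,
    ht.of_isClosed_subset isClosed_closure hsub, fun h => (htU (hsub h)).2 rfl⟩, ?_,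
    fun z hz => (htU (hsub hz)).1⟩
  · rintro _ ⟨x, hx, rfl⟩
    exact hb x (hs x hx)
  · refine Set.Subset.trans (fun z hz => ?_) subset_closure
    obtain ⟨x, hx, hz'⟩ := Set.mem_iUnion₂.1 (hKs hz)
    exact ⟨b x, ⟨x, hx, rfl⟩, hz'⟩

/-- The functions holomorphic near a compact set are separable for uniform convergence on it. -/
theorem exists_countable_dense_holomorphicNear {K : Set ℂ} (hK : IsCompact K) :
    ∃ 𝒬 : Set (ℂ → ℂ), 𝒬.Countable ∧ (∀ Q ∈ 𝒬, HolomorphicNear Q K) ∧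
      ∀ Q, HolomorphicNear Q K → ∀ ε > 0, ∃ Q' ∈ 𝒬, ∀ z ∈ K, ‖Q' z - Q z‖ < ε := by
  have : CompactSpace K := isCompact_iff_compactSpace.1 hK
  set S : Set C(K, ℂ) := {u | ∃ Q, HolomorphicNear Q K ∧ ∀ z : K, u z = Q z} with hS
  -- Subsets of the separable metric space `C(K, ℂ)` are separable, and the dense sequence can be
  -- taken inside `S`, hence among restrictions of holomorphic functions.
  obtain ⟨t, htS, htc, hSt⟩ :=
    (TopologicalSpace.IsSeparable.of_separableSpace S).exists_countable_dense_subset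
  choose G hG hGu using fun u : t => htS u.2
  have := htc.to_subtype
  refine ⟨Set.range G, Set.countable_range G, Set.forall_mem_range.2 hG, fun Q hQ ε hε => ?_⟩
  obtain ⟨U, hU, hKU, hQU⟩ := hQ
  set u : C(K, ℂ) := ⟨K.domRestrict Q, (hQU.continuousOn.mono hKU).domRestrict⟩ with hu
  have hmem : u ∈ S := ⟨Q, ⟨U, hU, hKU, hQU⟩, fun z => rfl⟩
  obtain ⟨v, hv, hvε⟩ := Metric.mem_closure_iff.1 (hSt hmem) ε hε
  refine ⟨G ⟨v, hv⟩, ⟨_, rfl⟩, fun z hz => ?_⟩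
  have h1 := (ContinuousMap.dist_apply_le_dist (f := u) (g := v) ⟨z, hz⟩).trans_lt hvε
  rw [dist_comm, dist_eq_norm, hGu ⟨v, hv⟩] at h1
  exact h1

/-- Given `K` and `Q`, a member `L ⊇ K` of the countable family fits into the domain where `Q` is
holomorphic, so `Q` can be replaced on `L` by a member of a countable dense set at a cost of `ε /
2`. Approximation on `L` implies approximation on `K`. -/
theorem padeUniversalWith_eq_sInter (e : Prop) (J : Set (ℕ × ℕ)) :
    ∃ 𝒪 : Set (Set ℂ⟦X⟧), 𝒪.Countable ∧ padeUniversalWith e J = ⋂₀ 𝒪 ∧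
      ∀ O ∈ 𝒪, ∃ (K : Set ℂ) (Q : ℂ → ℂ) (ε : ℝ), IsCompact K ∧ (0 : ℂ) ∉ K ∧
        HolomorphicNear Q K ∧ 0 < ε ∧ O = padeApprox e J K Q ε := by
  obtain ⟨𝒦, h𝒦c, h𝒦, hbetween⟩ := exists_countable_compacts_between
  choose! 𝒬 h𝒬c h𝒬 hdense using fun L (hL : L ∈ 𝒦) =>
    exists_countable_dense_holomorphicNear (h𝒦 L hL).1
  refine ⟨⋃ L ∈ 𝒦, ⋃ Q ∈ 𝒬 L, Set.range fun n : ℕ => padeApprox e J L Q (1 / ((n : ℝ) + 1)),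
    h𝒦c.biUnion fun L hL => (h𝒬c L hL).biUnion fun Q _ => Set.countable_range _, ?_, ?_⟩
  · refine Set.Subset.antisymm (fun f hf => ?_) fun f hf K hK h0 Q hQ ε hε => ?_
    · refine Set.mem_sInter.2 fun O hO => ?_
      simp only [Set.mem_iUnion, Set.mem_range] at hO
      obtain ⟨L, hL, Q, hQ, n, rfl⟩ := hO
      exact hf L (h𝒦 L hL).1 (h𝒦 L hL).2 Q (h𝒬 L hL Q hQ) _ Nat.one_div_pos_of_nat
    · obtain ⟨U, hU, hKU, hQU⟩ := hQ
      obtain ⟨L, hL, hKL, hLU⟩ := hbetween K U hK h0 hU hKU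
      obtain ⟨Q', hQ', hQQ'⟩ := hdense L hL Q ⟨U, hU, hLU, hQU⟩ (ε / 2) (half_pos hε)
      obtain ⟨n, hn⟩ := exists_nat_one_div_lt (half_pos hε)
      have hmem : f ∈ padeApprox e J L Q' (1 / ((n : ℝ) + 1)) := by
        refine Set.mem_sInter.1 hf _ ?_
        simp only [Set.mem_iUnion, Set.mem_range]
        exact ⟨L, hL, Q', hQ', n, rfl⟩
      rw [mem_padeApprox_iff] at hmem ⊢
      obtain ⟨p, q, A, B, h1, h2, h3, h4, h5⟩ := hmem
      refine ⟨p, q, A, B, h1, h2, h3, h4, fun z hz => ⟨(h5 z (hKL hz)).1, ?_⟩⟩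
      calc ‖A.eval z / B.eval z - Q z‖
          = ‖(A.eval z / B.eval z - Q' z) + (Q' z - Q z)‖ := by congr 1; ring
        _ ≤ _ := norm_add_le _ _
        _ < ε / 2 + ε / 2 := add_lt_add ((h5 z (hKL hz)).2.trans hn) (hQQ' z (hKL hz))
        _ = ε := add_halves ε
  · intro O hO
    simp only [Set.mem_iUnion, Set.mem_range] at hO
    obtain ⟨L, hL, Q, hQ, n, rfl⟩ := hO
    exact ⟨L, Q, _, (h𝒦 L hL).1, (h𝒦 L hL).2, h𝒬 L hL Q hQ, Nat.one_div_pos_of_nat, rfl⟩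

theorem isGδ_padeUniversalWith [TopologicalSpace ℂ⟦X⟧]
    (hc : ∀ n, Continuous fun f : ℂ⟦X⟧ => PowerSeries.coeff n f) (e : Prop) (J : Set (ℕ × ℕ)) :
    IsGδ (padeUniversalWith e J) := by
  obtain ⟨𝒪, hcount, heq, h𝒪⟩ := padeUniversalWith_eq_sInter e J
  refine ⟨𝒪, fun O hO => ?_, hcount, heq⟩
  obtain ⟨K, Q, ε, hK, -, hQ, -, rfl⟩ := h𝒪 O hO
  exact isOpen_padeApprox hc e J hK hQ ε

/-- Baire's theorem is applied in the complete ring metric only, where density means matching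
finitely many coefficients exactly. -/
theorem dense_padeUniversalWith (e : Prop) {J : Set (ℕ × ℕ)} (hJ : ConditionH J) :
    @Dense ℂ⟦X⟧ ringTopology (padeUniversalWith e J) := by
  obtain ⟨𝒪, hcount, heq, h𝒪⟩ := padeUniversalWith_eq_sInter e J
  let := ringMetric
  have : CompleteSpace ℂ⟦X⟧ := completeSpace_ringMetric
  rw [heq]
  refine dense_sInter_of_isOpen (fun O hO => ?_) hcount fun O hO => ?_
  · obtain ⟨K, Q, ε, hK, -, hQ, -, rfl⟩ := h𝒪 O hO
    exact isOpen_padeApprox continuous_coeff_ringTopology e J hK hQ ε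
  · obtain ⟨K, Q, ε, hK, h0, hQ, hε, rfl⟩ := h𝒪 O hO
    exact dense_padeApprox e hJ hK h0 hQ hε

theorem padeUniversalWith_residual (e : Prop) {J : Set (ℕ × ℕ)} (hJ : ConditionH J) :
    (padeUniversalWith e J).Nonempty ∧
      (@IsGδ ℂ⟦X⟧ cartesianTopology (padeUniversalWith e J) ∧
        @Dense ℂ⟦X⟧ cartesianTopology (padeUniversalWith e J)) ∧
      (@IsGδ ℂ⟦X⟧ ringTopology (padeUniversalWith e J) ∧
        @Dense ℂ⟦X⟧ ringTopology (padeUniversalWith e J)) := by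
  have hd := dense_padeUniversalWith e hJ
  refine ⟨@Dense.nonempty _ ringTopology _ _ hd, ⟨?_, fun f => ?_⟩, ?_, hd⟩
  · exact @isGδ_padeUniversalWith cartesianTopology continuous_coeff_cartesianTopology e J
  -- The Cartesian topology is coarser, so density is inherited from the ring topology.
  · exact closure.mono ringTopology_le_cartesianTopology (hd f)
  · exact @isGδ_padeUniversalWith ringTopology continuous_coeff_ringTopology e J

theorem theorem4p6 (J : Set (ℕ × ℕ)) (hJ : ConditionH J) :
    ((padeUniversal J).Nonempty ∧
      (@IsGδ ℂ⟦X⟧ cartesianTopology (padeUniversal J) ∧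
        @Dense ℂ⟦X⟧ cartesianTopology (padeUniversal J)) ∧
      (@IsGδ ℂ⟦X⟧ ringTopology (padeUniversal J) ∧
        @Dense ℂ⟦X⟧ ringTopology (padeUniversal J))) ∧
    ((exactPadeUniversal J).Nonempty ∧
      (@IsGδ ℂ⟦X⟧ cartesianTopology (exactPadeUniversal J) ∧
        @Dense ℂ⟦X⟧ cartesianTopology (exactPadeUniversal J)) ∧
      (@IsGδ ℂ⟦X⟧ ringTopology (exactPadeUniversal J) ∧
        @Dense ℂ⟦X⟧ ringTopology (exactPadeUniversal J))) := by
  rw [padeUniversal_eq, exactPadeUniversal_eq]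
  exact ⟨padeUniversalWith_residual False hJ, padeUniversalWith_residual True hJ⟩
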